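/- **Setup.** For a word $w=w_1\cdots w_m$ over a totally ordered alphabet put $w_0=w_{m+1}=\hat 0$, an extra element smaller than all letters. An index $0\le l\le m$ is an ascent, descent or plateau of $w$ if $w_l<w_{l+1}$, $w_l>w_{l+1}$ or $w_l=w_{l+1}$, respectively; $\mathrm{asc}(w),\mathrm{des}(w),\mathrm{plat}(w)$ are their numbers. Let $M_n=\{1,1,\bar 1,2,2,\bar 2,\dots,n,n,\bar n\}$ with $\bar 1<1<\bar 2<2<\cdots<\bar n<n$. For $S\subseteq[n]$ let $M_{n,S}=M_n\setminus\{\bar a: a\in S\}$, and let $\mathcal{JSP}_{n,S}$ be the set of permutations of the multiset $M_{n,S}$ such that, for each $a\in[n]$, all entries between the two occurrences of $a$ are larger than $a$. Put $\mathcal{JSP}_{n,i}=\bigcup_{|S|=i}\mathcal{JSP}_{n,S}$ and $$\mathrm{JSP}_{n,S}(x,y,z)=\sum_{\pi\in\mathcal{JSP}_{n,S}}x^{\mathrm{asc}(\pi)}y^{\mathrm{des}(\pi)}z^{\mathrm{plat}(\pi)},\qquad \mathrm{JSP}_{n,i}(x,y,z)=\sum_{\pi\in\mathcal{JSP}_{n,i}}x^{\mathrm{asc}(\pi)}y^{\mathrm{des}(\pi)}z^{\mathrm{plat}(\pi)}.$$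 For $\mathbf m=(m_1,\dots,m_N)$ with all $m_k\ge 1$, let $\mathcal Q_{\mathbf m}$ be the set of permutations of $\{1^{m_1},\dots,N^{m_N}\}$ in which no entry between two occurrences of a letter is smaller than that letter, and let $S_{\mathbf m}(x,y,z)=\sum_{\pi\in\mathcal Q_{\mathbf m}}x^{\mathrm{asc}(\pi)}y^{\mathrm{des}(\pi)}z^{\mathrm{plat}(\pi)}$. A letter $k$ is multiple if $m_k>1$ and single otherwise. For $\pi\in\mathcal Q_{\mathbf m}$ of length $m$ and $l\in[m]$, call $l$ an ascent-plateau if $\pi_{l-1}<\pi_l=\pi_{l+1}$, a peak if $\pi_{l-1}<\pi_l>\pi_{l+1}$, a free descent-plateau if $\pi_{l-1}>\pi_l=\pi_{l+1}$ and $\pi_r\ne\pi_l$ for all $1\le r<l$, and an unmovable plateau if $\pi_l=\pi_{l+1}$ and $l$ is neither an ascent-plateau nor a free descent-plateau. Let $\mathrm{sddes}(\pi)$ be the number of $l\in[m]$ with $\pi_{l-1}>\pi_l>\pi_{l+1}$ and $\pi_l$ single, $\mathrm{fdesp}(\pi)$ the number of free descent-plateaux, $\mathrm{ascpp}(\pi)$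 the number of ascent-plateaux and peaks, and $\mathrm{mdup}(\pi)$ the number of $l\in[m]$ that are unmovable plateaux or satisfy $\pi_l>\pi_{l+1}$ with $\pi_l$ multiple. Put $$\gamma_{\mathbf m,k,j}=\#\{\pi\in\mathcal Q_{\mathbf m}:\mathrm{sddes}(\pi)=\mathrm{fdesp}(\pi)=0,\ \mathrm{mdup}(\pi)=k,\ \mathrm{ascpp}(\pi)=j\}.$$ For $S\subseteq[n]$ let $\mathbf m(S)=(m_1,\dots,m_{2n-|S|})$, where $m_\ell=2$ if $\ell=p+|\{a\in[n]\setminus S: a\le p\}|$ for some $1\le p\le n$, and $m_\ell=1$ otherwise. A polynomial $h(x,y)$ is homogeneous $\gamma$-positive if $h(x,y)=\sum_{k=0}^{\lfloor d/2\rfloor}\gamma_k(xy)^k(x+y)^{d-2k}$ for some $d\ge 0$ and some $\gamma_k\ge 0$. A polynomial $p(x,y,z)=\sum_k s_k(x,y)z^k$ is partial $\gamma$-positive if every $s_k(x,y)$ is homogeneous $\gamma$-positive. **Statement.** Let $n\ge 1$ and $0\le i\le n$. Then the Jacobi–Stirling polynomial $\mathrm{JSP}_{n,i}(x,y,z)$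 is partial $\gamma$-positive. Moreover, $$\mathrm{JSP}_{n,i}(x,y,z)=\sum_{S\subseteq[n],\,|S|=i}\mathrm{JSP}_{n,S}(x,y,z),$$ and for every $S\subseteq[n]$ with $|S|=i$ one has $\mathrm{JSP}_{n,S}(x,y,z)=S_{\mathbf m(S)}(x,y,z)$, this polynomial is partial $\gamma$-positive, and $$\mathrm{JSP}_{n,S}(x,y,z)=\sum_{k=0}^{3n-i-1}z^k\sum_{j=1}^{\lfloor(3n-i+1-k)/2\rfloor}\gamma_{\mathbf m(S),k,j}\,(xy)^j(x+y)^{3n-i+1-k-2j}.$$ -/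

import Mathlib

open MvPolynomial

/-! ### Words and their statistics -/

/-- The `i`-th letter `w_i` (with `1 ≤ i ≤ length w`) of a word `w = w_1 ⋯ w_m`, with the convention
that `w_0` and `w_{m+1}` are an extra letter `⊥` smaller than all letters. -/
def letterAt {α : Type*} (w : List α) : ℕ → WithBot α
  | 0 => ⊥
  | i + 1 => (w[i]?).elim ⊥ (fun a => (a : WithBot α))

/-- Number of ascents: indices `0 ≤ i ≤ m` with `w_i < w_{i+1}`. -/
def asc {α : Type*} [LinearOrder α] (w : List α) : ℕ :=
  ((Finset.range (w.length + 1)).filter fun i => letterAt w i < letterAt w (i + 1)).card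

/-- Number of descents: indices `0 ≤ i ≤ m` with `w_i > w_{i+1}`. -/
def des {α : Type*} [LinearOrder α] (w : List α) : ℕ :=
  ((Finset.range (w.length + 1)).filter fun i => letterAt w (i + 1) < letterAt w i).card

/-- Number of plateaux: indices `0 ≤ i ≤ m` with `w_i = w_{i+1}`. -/
def plat {α : Type*} [LinearOrder α] (w : List α) : ℕ :=
  ((Finset.range (w.length + 1)).filter fun i => letterAt w i = letterAt w (i + 1)).card

/-- The sum `∑ x^{asc} y^{des} z^{plat}` over a finite set of words; the variables `x, y, z` are
`X 0, X 1, X 2`. -/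
noncomputable def statPoly {α : Type*} [LinearOrder α] (W : Finset (List α)) :
    MvPolynomial (Fin 3) ℤ :=
  ∑ w ∈ W, X 0 ^ asc w * X 1 ^ des w * X 2 ^ plat w

/-! ### Jacobi–Stirling permutations -/

/-- The ordered alphabet `1̄ < 1 < 2̄ < 2 < ⋯ < n̄ < n`, with `[n]` modelled by `Fin n`. The second
component is `false` for barred and `true` for unbarred letters. -/
abbrev JSLetter (n : ℕ) : Type := Fin n ×ₗ Bool

/-- The barred letter `ā`. -/
def barred {n : ℕ} (a : Fin n) : JSLetter n := toLex (a, false)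

/-- The unbarred letter `a`. -/
def unbarred {n : ℕ} (a : Fin n) : JSLetter n := toLex (a, true)

/-- The multiset `M_n = {1, 1, 1̄, …, n, n, n̄}`. -/
def jsFullMultiset (n : ℕ) : Multiset (JSLetter n) :=
  ∑ a : Fin n, {unbarred a, unbarred a, barred a}

/-- The multiset `M_{n,S}`: the letters `ā` with `a ∈ S` are removed from `M_n`. -/
def jsMultiset (n : ℕ) (S : Finset (Fin n)) : Multiset (JSLetter n) :=
  jsFullMultiset n - S.val.map barred

/-- For every `a ∈ [n]`, all entries between the two occurrences of `a` are larger than `a`. -/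
def IsJacobiStirling {n : ℕ} (w : List (JSLetter n)) : Prop :=
  ∀ a : Fin n, ∀ p q r : Fin w.length, p < q → q < r →
    w.get p = unbarred a → w.get r = unbarred a → unbarred a < w.get q

instance {n : ℕ} : DecidablePred (IsJacobiStirling (n := n)) := fun w => by
  unfold IsJacobiStirling; infer_instance

/-- The set of Jacobi–Stirling permutations of `M_{n,S}`. -/
def jspSet (n : ℕ) (S : Finset (Fin n)) : Finset (List (JSLetter n)) :=
  (jsMultiset n S).lists.toFinset.filter IsJacobiStirling

/-- Membership: `w` is an arrangement of `M_{n,S}` satisfying the Stirling condition. -/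
theorem mem_jspSet {n : ℕ} {S : Finset (Fin n)} {w : List (JSLetter n)} :
    w ∈ jspSet n S ↔ (w : Multiset (JSLetter n)) = jsMultiset n S ∧ IsJacobiStirling w := by
  rw [jspSet, Finset.mem_filter, Multiset.mem_toFinset, Multiset.mem_lists_iff]
  exact and_congr_left fun _ => eq_comm

/-- The set `JSP_{n,i}`, the union of the `JSP_{n,S}` over all `S` with `i` elements. -/
def jspSetOfCard (n i : ℕ) : Finset (List (JSLetter n)) :=
  (Finset.powersetCard i (Finset.univ : Finset (Fin n))).biUnion (jspSet n)

/-! ### Stirling permutations of a general multiset -/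

/-- The multiset `{1^{m_1}, …, N^{m_N}}`, with `[N]` modelled by `Fin N`. -/
def multMultiset {N : ℕ} (m : Fin N → ℕ) : Multiset (Fin N) :=
  ∑ k : Fin N, Multiset.replicate (m k) k

/-- No entry between two occurrences of a letter is smaller than that letter, i.e. all entries
between two consecutive occurrences of a letter are larger. -/
def IsGenStirling {N : ℕ} (w : List (Fin N)) : Prop :=
  ∀ p q r : Fin w.length, p < q → q < r → w.get p = w.get r → w.get p ≤ w.get q

instance {N : ℕ} : DecidablePred (IsGenStirling (N := N)) := fun w => by
  unfold IsGenStirling; infer_instance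

/-- The set of generalized Stirling permutations of `{1^{m_1}, …, N^{m_N}}`. -/
def genStirlingSet {N : ℕ} (m : Fin N → ℕ) : Finset (List (Fin N)) :=
  (multMultiset m).lists.toFinset.filter IsGenStirling

/-- Membership: `w` is an arrangement of the multiset satisfying the Stirling condition. -/
theorem mem_genStirlingSet {N : ℕ} {m : Fin N → ℕ} {w : List (Fin N)} :
    w ∈ genStirlingSet m ↔ (w : Multiset (Fin N)) = multMultiset m ∧ IsGenStirling w := by
  rw [genStirlingSet, Finset.mem_filter, Multiset.mem_toFinset, Multiset.mem_lists_iff]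
  exact and_congr_left fun _ => eq_comm

/-- The `i`-th letter exists and is multiple, that is, has multiplicity larger than one. -/
def IsMultipleAt {N : ℕ} (m : Fin N → ℕ) (w : List (Fin N)) (i : ℕ) : Prop :=
  ∃ k : Fin N, letterAt w i = (k : WithBot (Fin N)) ∧ 1 < m k

/-- The `i`-th letter exists and is single, that is, not multiple. -/
def IsSingleAt {N : ℕ} (m : Fin N → ℕ) (w : List (Fin N)) (i : ℕ) : Prop :=
  ∃ k : Fin N, letterAt w i = (k : WithBot (Fin N)) ∧ ¬ 1 < m k

/-- `w_{i-1} < w_i = w_{i+1}`. -/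
def IsAscentPlateau {N : ℕ} (w : List (Fin N)) (i : ℕ) : Prop :=
  letterAt w (i - 1) < letterAt w i ∧ letterAt w i = letterAt w (i + 1)

/-- `w_{i-1} < w_i > w_{i+1}`. -/
def IsPeak {N : ℕ} (w : List (Fin N)) (i : ℕ) : Prop :=
  letterAt w (i - 1) < letterAt w i ∧ letterAt w (i + 1) < letterAt w i

/-- `w_{i-1} > w_i = w_{i+1}`, and the letter `w_i` does not occur before position `i`. -/
def IsFreeDescentPlateau {N : ℕ} (w : List (Fin N)) (i : ℕ) : Prop :=
  letterAt w i < letterAt w (i - 1) ∧ letterAt w i = letterAt w (i + 1) ∧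
    ∀ l ∈ Finset.Icc 1 (i - 1), letterAt w l ≠ letterAt w i

/-- A plateau that is neither a free descent-plateau nor an ascent-plateau. -/
def IsUnmovablePlateau {N : ℕ} (w : List (Fin N)) (i : ℕ) : Prop :=
  letterAt w i = letterAt w (i + 1) ∧ ¬ IsFreeDescentPlateau w i ∧ ¬ IsAscentPlateau w i

open Classical in
/-- Number of single double-descents. -/
noncomputable def sddes {N : ℕ} (m : Fin N → ℕ) (w : List (Fin N)) : ℕ :=
  ((Finset.Icc 1 w.length).filter fun i =>
    letterAt w i < letterAt w (i - 1) ∧ letterAt w (i + 1) < letterAt w i ∧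
      IsSingleAt m w i).card

open Classical in
/-- Number of free descent-plateaux. -/
noncomputable def fdesp {N : ℕ} (w : List (Fin N)) : ℕ :=
  ((Finset.Icc 1 w.length).filter fun i => IsFreeDescentPlateau w i).card

open Classical in
/-- Number of ascent-plateaux and peaks. -/
noncomputable def ascpp {N : ℕ} (w : List (Fin N)) : ℕ :=
  ((Finset.Icc 1 w.length).filter fun i => IsAscentPlateau w i ∨ IsPeak w i).card

open Classical in
/-- Number of multiple descents and unmovable plateaux. -/
noncomputable def mdup {N : ℕ} (m : Fin N → ℕ) (w : List (Fin N)) : ℕ :=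
  ((Finset.Icc 1 w.length).filter fun i =>
    (letterAt w (i + 1) < letterAt w i ∧ IsMultipleAt m w i) ∨ IsUnmovablePlateau w i).card

/-- The coefficient `γ_{m,k,j}`: the number of generalized Stirling permutations `w` with
`sddes w = fdesp w = 0`, `mdup w = k` and `ascpp w = j`. -/
noncomputable def stirlingGamma {N : ℕ} (m : Fin N → ℕ) (k j : ℕ) : ℕ :=
  ((genStirlingSet m).filter fun w =>
    sddes m w = 0 ∧ fdesp w = 0 ∧ mdup m w = k ∧ ascpp w = j).card

/-- The vector `m(S) = (m_1, …, m_{2n-|S|})`, where `m_ℓ = 2` if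
`ℓ = p + |{a ∈ [n] ∖ S : a ≤ p}|` for some `p ∈ [n]`, and `m_ℓ = 1` otherwise. The shifts by one
account for `Fin` starting at `0`. -/
def multVec {n : ℕ} (S : Finset (Fin n)) : Fin (2 * n - S.card) → ℕ := fun l =>
  if ∃ p : Fin n, (l : ℕ) + 1 = ((p : ℕ) + 1) + ((Finset.univ \ S).filter (· ≤ p)).card
  then 2 else 1

/-! ### Gamma-positivity -/

/-- `h(x, y) = ∑_{k ≤ d/2} γ_k (x y)^k (x + y)^{d - 2k}` for some `d` and some `γ_k ≥ 0`. -/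
def IsHomogeneousGammaPositive (h : MvPolynomial (Fin 2) ℤ) : Prop :=
  ∃ (d : ℕ) (γ : ℕ → ℤ), (∀ k, 0 ≤ γ k) ∧
    h = ∑ k ∈ Finset.range (d / 2 + 1), C (γ k) * (X 0 * X 1) ^ k * (X 0 + X 1) ^ (d - 2 * k)

/-- `p(x, y, z) = ∑_i s_i(x, y) z^i` with every `s_i` homogeneous `γ`-positive. -/
def IsPartialGammaPositive (p : MvPolynomial (Fin 3) ℤ) : Prop :=
  ∃ (N : ℕ) (s : ℕ → MvPolynomial (Fin 2) ℤ),
    p = ∑ i ∈ Finset.range N, rename Fin.castSucc (s i) * X 2 ^ i ∧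
    ∀ i ∈ Finset.range N, IsHomogeneousGammaPositive (s i)

/-! Only multiplicities one and two occur, and Stirling words are built by inserting the copies of
the largest letter `N` as one contiguous block (`sum_stirlingWords_insert`). Two weightings are
followed through this construction.

Weight each adjacent pair by x, y or z (ascent, descent, plateau). A block put into a gap replaces
that gap's factor by xyz^(j-1), where j is the block length. Summing over gaps is therefore
xyz^(j-1) times the derivation sending x, y, z to 1.

Weight each letter by its neighbours instead (`tripleWeight`): a for ascent-plateaux and peaks, c
for double ascents, d for single double descents and free descent-plateaux, z for multiple descents,
and 1 for the rest. Insertion now acts as az^(j-1)D with Da = c + d and Dc = Dd = Dz = 1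
(`innerInsertionSum_tripleProd`). For a = xy, c = x, d = y the two recurrences and their initial
values agree, so the two sums agree (`sum_edgeProd_eq_sum_wordWeight`).

Moreover D preserves the ring generated by a, c + d and z, so the letter-weighted sum depends on c
and d only through c + d. Replacing (c, d) by (c + d, 0) leaves the words with `sddes = fdesp = 0`,
each weighted (xy)^j (x+y)^l z^k with 2j + l + k equal to the length plus one. This is the
γ-expansion. Jacobi–Stirling permutations are the case of the alphabet of M_{n,S}, relabelled
increasingly; all S of one size give the same length, so their expansions add up. -/

/-! ### Words with a left boundary letter -/

section Boundary

variable {α : Type*}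

/-- The first letter of a word, or `⊥` for the empty word. -/
def firstLetter : List α → WithBot α
  | [] => ⊥
  | k :: _ => k

/-- The letters of a word preceded by the boundary letter `p` and followed by `⊥`. -/
def letterFrom (p : WithBot α) (w : List α) : ℕ → WithBot α
  | 0 => p
  | i + 1 => (w[i]?).elim ⊥ (fun a => (a : WithBot α))

theorem letterAt_eq_letterFrom (w : List α) : letterAt w = letterFrom ⊥ w := by
  funext i
  cases i <;> rfl

theorem letterFrom_cons_succ (p : WithBot α) (k : α) (w : List α) (i : ℕ) :
    letterFrom p (k :: w) (i + 1) = letterFrom k w i := by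
  cases i <;> simp [letterFrom]

theorem letterFrom_one (p : WithBot α) (w : List α) : letterFrom p w 1 = firstLetter w := by
  cases w <;> simp [letterFrom, firstLetter]

theorem firstLetter_cons (k : α) (w : List α) : firstLetter (k :: w) = k := rfl

theorem firstLetter_append {u v : List α} (h : u ≠ []) : firstLetter (u ++ v) = firstLetter u := by
  cases u with
  | nil => exact absurd rfl h
  | cons k u => rfl

theorem firstLetter_replicate_one_or_two (N : α) {j : ℕ} (hj : j = 1 ∨ j = 2) :
    firstLetter (List.replicate j N) = N := by
  rcases hj with rfl | rfl <;> rfl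

end Boundary

/-! ### Letter weights, edge weights and local Stirling constraints -/

section Local

variable {α : Type*} [LinearOrder α] {R : Type*} [CommRing R]

/-- The letter `k` exists and has multiplicity larger than one. -/
def IsMultipleLetter (m : α → ℕ) (k : WithBot α) : Prop :=
  ∃ l : α, k = l ∧ 1 < m l

open Classical in
/-- The weight of a letter `k` with neighbours `p` and `q`. -/
noncomputable def tripleWeight (m : α → ℕ) (a c d z : R) (p k q : WithBot α) : R :=
  if p < k then if k < q then c else a
  else if k < q then 1
  else if k < p ∧ (k = q ∨ ¬ IsMultipleLetter m k) then d else z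

/-- The product of the weights of all letters of a word with left boundary `p`. -/
noncomputable def tripleProd (m : α → ℕ) (a c d z : R) : WithBot α → List α → R
  | _, [] => 1
  | p, k :: w => tripleWeight m a c d z p k (firstLetter w) * tripleProd m a c d z k w

/-- The weight of an ascent, a descent or a plateau. -/
def edgeWeight (x y z : R) (p q : WithBot α) : R :=
  if p < q then x else if q < p then y else z

/-- The product of the weights of all adjacent pairs of a word with left boundary `p`. -/
def edgeProd (x y z : R) : WithBot α → List α → R
  | p, [] => edgeWeight x y z p ⊥
  | p, k :: w => edgeWeight x y z p k * edgeProd x y z k w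

/-- The constraints that a Stirling permutation with multiplicities at most two imposes on a
letter `k` and its neighbours. -/
def LocallyStirlingAt (m : α → ℕ) (p k q : WithBot α) : Prop :=
  (k = q → IsMultipleLetter m k) ∧ (p < k → q < k → ¬ IsMultipleLetter m k) ∧ ¬ (p = k ∧ k = q)

/-- `LocallyStirlingAt` holds at all letters of a word with left boundary `p`. -/
def LocallyStirling (m : α → ℕ) : WithBot α → List α → Prop
  | _, [] => True
  | p, k :: w => LocallyStirlingAt m p k (firstLetter w) ∧ LocallyStirling m k w

theorem tripleProd_eq_prod (m : α → ℕ) (a c d z : R) (p : WithBot α) (w : List α) :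
    tripleProd m a c d z p w = ∏ i ∈ Finset.range w.length, tripleWeight m a c d z
      (letterFrom p w i) (letterFrom p w (i + 1)) (letterFrom p w (i + 2)) := by
  induction w generalizing p with
  | nil => rfl
  | cons k w ih =>
    rw [List.length_cons, Finset.prod_range_succ', tripleProd, ih, mul_comm]
    simp only [letterFrom_cons_succ, letterFrom_one]
    rfl

theorem edgeProd_eq_prod (x y z : R) (p : WithBot α) (w : List α) :
    edgeProd x y z p w = ∏ i ∈ Finset.range (w.length + 1), edgeWeight x y z
      (letterFrom p w i) (letterFrom p w (i + 1)) := by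
  induction w generalizing p with
  | nil => simp [edgeProd, letterFrom]
  | cons k w ih =>
    rw [List.length_cons, Finset.prod_range_succ', edgeProd, ih, mul_comm]
    simp only [letterFrom_cons_succ]
    rfl

theorem locallyStirling_of_forall {m : α → ℕ} {p : WithBot α} {w : List α}
    (h : ∀ i < w.length, LocallyStirlingAt m
      (letterFrom p w i) (letterFrom p w (i + 1)) (letterFrom p w (i + 2))) :
    LocallyStirling m p w := by
  induction w generalizing p with
  | nil => trivial
  | cons k w ih =>
    refine ⟨?_, ih fun i hi => ?_⟩
    · have := h 0 (by simp)
      simp only [letterFrom_cons_succ, letterFrom_one] at this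
      exact this
    · have := h (i + 1) (by simpa using hi)
      simpa only [letterFrom_cons_succ] using this

/-! ### Inserting a block of the largest letter -/

theorem tripleProd_congr_boundary {m : α → ℕ} {a c d z : R} {p p' : WithBot α} {w : List α}
    (h : firstLetter w < p) (h' : firstLetter w < p') :
    tripleProd m a c d z p w = tripleProd m a c d z p' w := by
  cases w with
  | nil => rfl
  | cons k w =>
    replace h : (k : WithBot α) < p := h
    replace h' : (k : WithBot α) < p' := h'
    unfold tripleProd tripleWeight
    rw [if_neg h.not_gt, if_neg h'.not_gt]
    split_ifs <;> tauto

/-- Raising the left neighbour of a first letter that is not preceded by an ascent does not change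
its weight. The delicate case is the second copy in a plateau: once separated from its twin it could
become a double descent, but being multiple it keeps weight z. -/
theorem tripleProd_eq_of_firstLetter_le {m : α → ℕ} {a c d z : R} {k N : WithBot α} {w : List α}
    (hk : firstLetter w ≤ k) (hN : k < N) (hw : LocallyStirling m k w)
    (hm : firstLetter w = k → IsMultipleLetter m k) :
    tripleProd m a c d z N w = tripleProd m a c d z k w := by
  rcases hk.lt_or_eq with h | h
  · exact tripleProd_congr_boundary (h.trans hN) h
  · cases w with
    | nil => rfl
    | cons l w =>
      have hlm := hm h
      obtain rfl : (l : WithBot α) = k := h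
      obtain ⟨-, -, h3⟩ := hw.1
      have h3 : ((l : WithBot α)) ≠ firstLetter w := fun h => h3 ⟨rfl, h⟩
      simp [tripleProd, tripleWeight, hN, hN.not_gt, h3, hlm]

/-- Sum over all insertions of the block `B` after the first letter. -/
noncomputable def innerInsertionSum (F : WithBot α → List α → R) (B : List α) (p : WithBot α)
    (w : List α) : R :=
  ∑ i ∈ Finset.range w.length, F p (w.take (i + 1) ++ B ++ w.drop (i + 1))

theorem firstLetter_lt {w : List α} {N : α} (h : ∀ k ∈ w, k < N) :
    firstLetter w < (N : WithBot α) := by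
  cases w with
  | nil => exact WithBot.bot_lt_coe N
  | cons k w => exact WithBot.coe_lt_coe.2 (h k (by simp))

theorem innerInsertionSum_tripleProd_cons {m : α → ℕ} {a c d z β : R} {N k : α} {B : List α}
    {p : WithBot α} {w : List α}
    (hB : firstLetter B = N) (hN : ∀ l ∈ k :: w, l < N)
    (hβ : ∀ (q : WithBot α) (v : List α), q < N → (∀ l ∈ v, l < N) →
      tripleProd m a c d z q (B ++ v) = β * tripleProd m a c d z N v) :
    innerInsertionSum (tripleProd m a c d z) B p (k :: w) =
      tripleWeight m a c d z p k N * (β * tripleProd m a c d z N w) +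
      tripleWeight m a c d z p k (firstLetter w) *
        innerInsertionSum (tripleProd m a c d z) B k w := by
  have hk : (k : WithBot α) < N := WithBot.coe_lt_coe.2 (hN k (by simp))
  have hw : ∀ l ∈ w, l < N := fun l hl => hN l (by simp [hl])
  have hB0 : B ≠ [] := by rintro rfl; simp [firstLetter] at hB
  rw [innerInsertionSum, List.length_cons, Finset.sum_range_succ', add_comm, innerInsertionSum,
    Finset.mul_sum]
  congr 1
  · simp [tripleProd, hβ k w hk hw, firstLetter_append hB0, hB]
  · refine Finset.sum_congr rfl fun i hi => ?_
    have : w ≠ [] := by rintro rfl; simp at hi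
    have hf : firstLetter (w.take (i + 1) ++ B ++ w.drop (i + 1)) = firstLetter w := by
      cases w with
      | nil => exact absurd rfl this
      | cons l w => rfl
    rw [← hf]
    rfl

/-- Charge every ascent gap to the letter on its right and every other gap to the letter on its
left. A letter of weight a is then charged twice and becomes d or c; weights c, d, z are charged
once and become 1; weight 1 is charged nothing. This is the Leibniz rule for D. The conditional term
is the gap before `w`, which belongs to `w` only if it is an ascent. -/
theorem innerInsertionSum_tripleProd {m : α → ℕ} {a c d z β : R} {N : α} {B : List α}
    (D : Derivation ℤ R R) (ha : D a = c + d) (hc : D c = 1) (hd : D d = 1) (hz : D z = 1)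
    (hB : firstLetter B = N)
    (hβ : ∀ (q : WithBot α) (v : List α), q < N → (∀ l ∈ v, l < N) →
      tripleProd m a c d z q (B ++ v) = β * tripleProd m a c d z N v)
    {p : WithBot α} {w : List α} (hN : ∀ l ∈ w, l < N) (hw : LocallyStirling m p w) :
    (if p < firstLetter w then β * tripleProd m a c d z N w else 0) +
      innerInsertionSum (tripleProd m a c d z) B p w = β * D (tripleProd m a c d z p w) := by
  induction w generalizing p with
  | nil => simp [firstLetter, innerInsertionSum, tripleProd]
  | cons k w ih =>
    have hkN : (k : WithBot α) < N := WithBot.coe_lt_coe.2 (hN k (by simp))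
    have hwN : ∀ l ∈ w, l < N := fun l hl => hN l (by simp [hl])
    have ih := ih hwN hw.2
    rw [innerInsertionSum_tripleProd_cons hB hN hβ]
    obtain ⟨⟨h1, h2, h3⟩, hw⟩ := hw
    have key : firstLetter w ≤ k → tripleProd m a c d z N w = tripleProd m a c d z k w :=
      fun h => tripleProd_eq_of_firstLetter_le h hkN hw fun h => h1 h.symm
    have hleib : D (tripleProd m a c d z p (k :: w)) =
        D (tripleWeight m a c d z p k (firstLetter w)) * tripleProd m a c d z k w +
        tripleWeight m a c d z p k (firstLetter w) * D (tripleProd m a c d z k w) := by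
      simp only [tripleProd, Derivation.leibniz, smul_eq_mul]
      ring
    have hfk : firstLetter (k :: w) = k := rfl
    have hNk : tripleProd m a c d z N (k :: w) =
        tripleWeight m a c d z N k (firstLetter w) * tripleProd m a c d z k w := rfl
    rw [hleib, hfk, hNk]
    -- The four cases are weight c, weight a, weight 1, and weight d or z, in this order.
    by_cases hp : p < k <;> by_cases hq : (k : WithBot α) < firstLetter w
    · have e1 : tripleWeight m a c d z p k (firstLetter w) = c := by simp [tripleWeight, hp, hq]
      have e2 : tripleWeight m a c d z N k (firstLetter w) = 1 := by
        simp [tripleWeight, hkN.not_gt, hq]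
      have e3 : tripleWeight m a c d z p k N = c := by simp [tripleWeight, hp, hkN]
      rw [if_pos hq] at ih
      rw [if_pos hp, e1, e2, e3, hc]
      linear_combination c * ih
    · have e1 : tripleWeight m a c d z p k (firstLetter w) = a := by simp [tripleWeight, hp, hq]
      have e2 : tripleWeight m a c d z N k (firstLetter w) = d := by
        rcases (not_lt.1 hq).lt_or_eq with h | h
        · simp [tripleWeight, hkN.not_gt, hq, hkN, h2 hp h]
        · simp [tripleWeight, hkN.not_gt, hkN, h]
      have e3 : tripleWeight m a c d z p k N = c := by simp [tripleWeight, hp, hkN]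
      rw [if_neg hq] at ih
      rw [if_pos hp, e1, e2, e3, ha, key (not_lt.1 hq)]
      linear_combination a * ih
    · have e1 : tripleWeight m a c d z p k (firstLetter w) = 1 := by simp [tripleWeight, hp, hq]
      have e3 : tripleWeight m a c d z p k N = 1 := by simp [tripleWeight, hp, hkN]
      rw [if_pos hq] at ih
      rw [if_neg hp, e1, e3, Derivation.map_one_eq_zero]
      linear_combination ih
    · have e1 : D (tripleWeight m a c d z p k (firstLetter w)) = 1 := by
        simp only [tripleWeight, hp, hq, if_false]
        split_ifs <;> assumption
      have e3 : tripleWeight m a c d z p k N = 1 := by simp [tripleWeight, hp, hkN]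
      rw [if_neg hq] at ih
      rw [if_neg hp, e1, e3, key (not_lt.1 hq)]
      linear_combination tripleWeight m a c d z p k (firstLetter w) * ih

/-- Sum over all insertions of the block `B` into the word `w`. -/
noncomputable def insertionSum (f : List α → R) (B w : List α) : R :=
  ∑ i ∈ Finset.range (w.length + 1), f (w.take i ++ B ++ w.drop i)

theorem insertionSum_tripleProd {m : α → ℕ} {a c d z β : R} {N : α} {B : List α}
    (D : Derivation ℤ R R) (ha : D a = c + d) (hc : D c = 1) (hd : D d = 1) (hz : D z = 1)
    (hB : firstLetter B = N)
    (hβ : ∀ (q : WithBot α) (v : List α), q < N → (∀ l ∈ v, l < N) →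
      tripleProd m a c d z q (B ++ v) = β * tripleProd m a c d z N v)
    {w : List α} (hN : ∀ l ∈ w, l < N) (hw : LocallyStirling m ⊥ w) (hw0 : w ≠ []) :
    insertionSum (tripleProd m a c d z ⊥) B w = β * D (tripleProd m a c d z ⊥ w) := by
  rw [← innerInsertionSum_tripleProd D ha hc hd hz hB hβ hN hw, insertionSum,
    Finset.sum_range_succ', innerInsertionSum, if_pos, add_comm]
  · simp [hβ ⊥ w (WithBot.bot_lt_coe N) hN]
  · cases w with
    | nil => exact absurd rfl hw0
    | cons k w => exact WithBot.bot_lt_coe k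

/-- The product of the weights of all adjacent pairs of a word, without left boundary. -/
def edgeTail (x y z : R) : List α → R
  | [] => 1
  | k :: w => edgeProd x y z k w

theorem edgeProd_eq_mul_edgeTail (x y z : R) (p : WithBot α) (w : List α) :
    edgeProd x y z p w = edgeWeight x y z p (firstLetter w) * edgeTail x y z w := by
  cases w <;> simp [edgeProd, edgeTail, firstLetter]

/-- A block of the largest letter changes only the factor of its own gap, and D sends each such
factor to 1. -/
theorem insertionSum_edgeProd {x y z β : R} {N : α} {B : List α}
    (D : Derivation ℤ R R) (hx : D x = 1) (hy : D y = 1) (hz : D z = 1)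
    (hβ : ∀ (q : WithBot α) (v : List α), q < N → (∀ l ∈ v, l < N) →
      edgeProd x y z q (B ++ v) = β * edgeTail x y z v)
    {p : WithBot α} (hp : p < N) {w : List α} (hN : ∀ l ∈ w, l < N) :
    insertionSum (edgeProd x y z p) B w = β * D (edgeProd x y z p w) := by
  have hD : ∀ p q : WithBot α, D (edgeWeight x y z p q) = 1 := fun p q => by
    unfold edgeWeight; split_ifs <;> assumption
  induction w generalizing p with
  | nil =>
    have := hβ p [] hp (by simp)
    rw [List.append_nil] at this
    simp [insertionSum, this, edgeProd, edgeTail, hD]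
  | cons k w ih =>
    have hk : (k : WithBot α) < N := WithBot.coe_lt_coe.2 (hN k (by simp))
    have ih := ih hk fun l hl => hN l (by simp [hl])
    rw [insertionSum] at ih
    rw [insertionSum, List.length_cons, Finset.sum_range_succ']
    simp only [List.take_succ_cons, List.drop_succ_cons, List.cons_append, edgeProd,
      ← Finset.mul_sum, ih, List.take_zero, List.drop_zero, List.nil_append, hβ p _ hp hN,
      Derivation.leibniz, smul_eq_mul, hD, edgeTail]
    ring

/-- The first copy of `N` is a peak or an ascent-plateau, of weight a; a second copy is a descent
after a plateau, of weight z. -/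
theorem tripleProd_replicate_append (m : α → ℕ) (a c d z : R) {N : α} {j : ℕ}
    (hj : j = 1 ∨ j = 2) (q : WithBot α) (v : List α) (hq : q < N) (hv : ∀ l ∈ v, l < N) :
    tripleProd m a c d z q (List.replicate j N ++ v) =
      a * z ^ (j - 1) * tripleProd m a c d z N v := by
  have h := firstLetter_lt hv
  rcases hj with rfl | rfl
  · simp [tripleProd, tripleWeight, hq, h.not_gt]
  · simp [List.replicate, tripleProd, tripleWeight, hq, h.not_gt, firstLetter_cons, mul_assoc]

theorem edgeProd_replicate_append (x y z : R) {N : α} {j : ℕ}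
    (hj : j = 1 ∨ j = 2) (q : WithBot α) (v : List α) (hq : q < N) (hv : ∀ l ∈ v, l < N) :
    edgeProd x y z q (List.replicate j N ++ v) = x * y * z ^ (j - 1) * edgeTail x y z v := by
  have h := firstLetter_lt hv
  rcases hj with rfl | rfl
  · simp [edgeProd, edgeProd_eq_mul_edgeTail x y z N v, edgeWeight, hq, h, h.not_gt, mul_assoc]
  · simp [List.replicate, edgeProd, edgeProd_eq_mul_edgeTail x y z N v, edgeWeight, hq, h,
      h.not_gt]
    ring

end Local

/-! ### Stirling words over a linear order -/

theorem triple_sublist_iff {α : Type*} {w : List α} {a b c : α} :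
    [a, b, c].Sublist w ↔ ∃ p q r : Fin w.length, p < q ∧ q < r ∧
      w.get p = a ∧ w.get q = b ∧ w.get r = c := by
  constructor
  · intro h
    obtain ⟨f, hf⟩ := List.sublist_iff_exists_fin_orderEmbedding_get_eq.1 h
    refine ⟨f ⟨0, by simp⟩, f ⟨1, by simp⟩, f ⟨2, by simp⟩, ?_, ?_, ?_, ?_, ?_⟩
    · simp
    · simp
    · exact (hf ⟨0, by simp⟩).symm
    · exact (hf ⟨1, by simp⟩).symm
    · exact (hf ⟨2, by simp⟩).symm
  · rintro ⟨p, q, r, hpq, hqr, rfl, rfl, rfl⟩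
    have : List.Pairwise (· < ·) [p, q, r] := by simp [hpq, hqr, hpq.trans hqr]
    simpa using List.map_getElem_sublist this

theorem letterAt_succ_of_lt {α : Type*} {w : List α} {i : ℕ} (hi : i < w.length) :
    letterAt w (i + 1) = (w[i] : α) := by
  simp [letterAt, hi]

theorem exists_of_letterAt_eq_coe {α : Type*} {w : List α} {i : ℕ} {k : α} (h : letterAt w i = k) :
    ∃ j, ∃ hj : j < w.length, i = j + 1 ∧ w[j] = k := by
  cases i with
  | zero => exact absurd h WithBot.bot_ne_coe
  | succ j =>
    by_cases hj : j < w.length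
    · rw [letterAt_succ_of_lt hj] at h
      exact ⟨j, hj, rfl, WithBot.coe_injective h⟩
    · simp [letterAt, hj] at h

section Words

variable {α : Type*} [LinearOrder α]

/-- All entries between two occurrences of a letter are at least that letter. -/
def IsStirlingWord (w : List α) : Prop := ∀ a b, [a, b, a].Sublist w → a ≤ b

theorem isStirlingWord_iff {w : List α} :
    IsStirlingWord w ↔ ∀ p q r : Fin w.length, p < q → q < r → w.get p = w.get r →
      w.get p ≤ w.get q := by
  constructor
  · intro h p q r hpq hqr hpr
    exact h _ _ (triple_sublist_iff.2 ⟨p, q, r, hpq, hqr, rfl, rfl, hpr.symm⟩)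
  · intro h a b hab
    obtain ⟨p, q, r, hpq, hqr, rfl, rfl, hr⟩ := triple_sublist_iff.1 hab
    exact h p q r hpq hqr hr.symm

open Classical in
/-- The Stirling words in which every letter `k ∈ A` occurs `m k` times. -/
noncomputable def stirlingWords (m : α → ℕ) (A : Finset α) : Finset (List α) :=
  (∑ k ∈ A, Multiset.replicate (m k) k).lists.toFinset.filter IsStirlingWord

theorem count_sum_replicate (m : α → ℕ) (A : Finset α) (k : α) :
    (∑ l ∈ A, Multiset.replicate (m l) l).count k = if k ∈ A then m k else 0 := by
  simp [Multiset.count_sum', Multiset.count_replicate]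

theorem mem_stirlingWords {m : α → ℕ} {A : Finset α} {w : List α} :
    w ∈ stirlingWords m A ↔
      (∀ k, w.count k = if k ∈ A then m k else 0) ∧ IsStirlingWord w := by
  have h : (∑ k ∈ A, Multiset.replicate (m k) k = (w : Multiset α)) ↔
      ∀ k, w.count k = if k ∈ A then m k else 0 := by
    rw [Multiset.ext]
    simp only [count_sum_replicate, Multiset.coe_count, eq_comm]
  classical
  rw [stirlingWords, Finset.mem_filter, Multiset.mem_toFinset, Multiset.mem_lists_iff, ← h]
  rfl

theorem stirlingWords_empty (m : α → ℕ) : stirlingWords m (∅ : Finset α) = {[]} := by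
  ext w
  rw [mem_stirlingWords, Finset.mem_singleton]
  constructor
  · rintro ⟨h, -⟩
    refine List.eq_nil_iff_forall_not_mem.2 fun k hk => ?_
    have := h k
    rw [if_neg (Finset.notMem_empty k)] at this
    exact List.count_eq_zero.1 this hk
  · rintro rfl
    exact ⟨by simp, fun a b h => by simp at h⟩

theorem mem_of_mem_stirlingWords {m : α → ℕ} {A : Finset α} {w : List α}
    (hw : w ∈ stirlingWords m A) {k : α} (hk : k ∈ w) : k ∈ A := by
  by_contra h
  have := (mem_stirlingWords.1 hw).1 k
  rw [if_neg h] at this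
  exact List.count_eq_zero.1 this hk

/-! #### Inserting a block of the largest letter -/

theorem filter_ne_append_replicate {N : α} {j : ℕ} {u v : List α} (hu : N ∉ u) (hv : N ∉ v) :
    (u ++ List.replicate j N ++ v).filter (· ≠ N) = u ++ v := by
  have e : ∀ {l : List α}, N ∉ l → l.filter (· ≠ N) = l := fun h =>
    List.filter_eq_self.2 fun a ha => by simpa using fun h' : a = N => h (h' ▸ ha)
  rw [List.filter_append, List.filter_append, e hu, e hv]
  simp

theorem takeWhile_ne_append_replicate {N : α} {j : ℕ} (hj : j = 1 ∨ j = 2) {u v : List α}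
    (hu : N ∉ u) : (u ++ List.replicate j N ++ v).takeWhile (· ≠ N) = u := by
  rw [List.append_assoc, List.takeWhile_append_of_pos]
  · rcases hj with rfl | rfl <;> simp [List.replicate]
  · intro a ha
    simpa using fun h : a = N => hu (h ▸ ha)

theorem isStirlingWord_append_replicate {N : α} {j : ℕ} (hj : j = 1 ∨ j = 2) {u v : List α}
    (hu : ∀ l ∈ u, l < N) (hv : ∀ l ∈ v, l < N) (h : IsStirlingWord (u ++ v)) :
    IsStirlingWord (u ++ List.replicate j N ++ v) := by
  have hu' : N ∉ u := fun h => (hu N h).false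
  have hv' : N ∉ v := fun h => (hv N h).false
  intro a b hab
  have hmem : ∀ l, l ∈ u ++ List.replicate j N ++ v → l ≤ N := by
    intro l hl
    simp only [List.mem_append, List.mem_replicate] at hl
    rcases hl with (hl | hl) | hl
    · exact (hu l hl).le
    · exact hl.2.le
    · exact (hv l hl).le
  have haN : a ≤ N := hmem a (hab.subset (by simp))
  by_cases hb : b = N
  · exact hb ▸ haN
  by_cases ha : a = N
  -- The copies of the largest letter are adjacent, so no other letter lies between them.
  · subst ha
    exfalso
    rw [List.append_assoc, List.sublist_append_iff] at hab
    obtain ⟨l1, l2, hl, h1, h2⟩ := hab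
    have : l1 = [] := by
      cases l1 with
      | nil => rfl
      | cons x l1 =>
        simp only [List.cons_append, List.cons.injEq] at hl
        exact absurd (h1.subset (by simp [hl.1])) hu'
    subst this
    rw [List.nil_append] at hl
    subst hl
    rcases hj with rfl | rfl
    · have := (List.cons_sublist_cons.1 h2).subset (by simp : a ∈ [b, a])
      exact hv' this
    · have h3 : [b, a].Sublist (a :: v) := List.cons_sublist_cons.1 h2
      cases h3 with
      | cons _ h4 => exact hv' (h4.subset (by simp))
      | cons_cons _ h4 => exact hb rfl
  · refine h a b ?_
    have := hab.filter (· ≠ N)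
    rw [filter_ne_append_replicate hu' hv'] at this
    simpa [ha, hb] using this

/-- An entry between two copies of the maximum would be at least the maximum, hence a third copy. -/
theorem exists_eq_append_replicate {N : α} {j : ℕ} (hj : j = 1 ∨ j = 2) {w : List α}
    (hN : ∀ l ∈ w, l ≤ N) (hc : w.count N = j) (hw : IsStirlingWord w) :
    ∃ u v, N ∉ u ∧ N ∉ v ∧ w = u ++ List.replicate j N ++ v := by
  have hmem : N ∈ w := List.count_pos_iff.1 (by omega)
  obtain ⟨u, v, rfl, hu⟩ := List.eq_append_cons_of_mem hmem
  rw [List.count_append, List.count_eq_zero.2 hu, List.count_cons_self] at hc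
  rcases hj with rfl | rfl
  · exact ⟨u, v, hu, List.count_eq_zero.1 (by omega), by simp⟩
  · obtain ⟨t, v, rfl, ht⟩ := List.eq_append_cons_of_mem
      (List.count_pos_iff.1 (by omega : 0 < v.count N))
    rw [List.count_append, List.count_eq_zero.2 ht, List.count_cons_self] at hc
    have ht0 : t = [] := by
      refine List.eq_nil_iff_forall_not_mem.2 fun b hb => ?_
      have hs : [N, b, N].Sublist (u ++ N :: (t ++ N :: v)) := by
        refine List.Sublist.trans ?_ (List.sublist_append_right _ _)
        refine List.Sublist.cons_cons _ ?_
        exact (List.singleton_sublist.2 hb).append (l₁ := [b]) (r₁ := [N])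
          (List.singleton_sublist.2 (by simp))
      have := hw _ _ hs
      have hbN := hN b (by simp [hb])
      exact ht (le_antisymm hbN this ▸ hb)
    subst ht0
    exact ⟨u, v, hu, List.count_eq_zero.1 (by omega), by simp⟩

/-- Insertion is bijective: deleting `N` recovers the word, and the prefix before the first `N`
recovers the position. -/
theorem sum_stirlingWords_insert {R : Type*} [CommRing R] {m : α → ℕ} {A : Finset α} {N : α}
    (hm : m N = 1 ∨ m N = 2) (hN : ∀ k ∈ A, k < N) (f : List α → R) :
    ∑ w ∈ stirlingWords m (insert N A), f w =
      ∑ w ∈ stirlingWords m A, insertionSum f (List.replicate (m N) N) w := by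
  have hNA : N ∉ A := fun h => (hN N h).false
  have hlt : ∀ w ∈ stirlingWords m A, ∀ l ∈ w, l < N := fun w hw l hl =>
    hN l (mem_of_mem_stirlingWords hw hl)
  have hnot : ∀ w ∈ stirlingWords m A, N ∉ w := fun w hw h => (hlt w hw N h).false
  simp only [insertionSum]
  rw [Finset.sum_sigma']
  symm
  refine Finset.sum_bij (fun x _ => x.1.take x.2 ++ List.replicate (m N) N ++ x.1.drop x.2)
    ?_ ?_ ?_ ?_
  · rintro ⟨w, i⟩ hx
    rw [Finset.mem_sigma] at hx
    obtain ⟨hw, -⟩ := hx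
    simp only at hw ⊢
    have hw' := mem_stirlingWords.1 hw
    refine mem_stirlingWords.2 ⟨fun k => ?_, ?_⟩
    · have h1 := hw'.1 k
      rw [← List.take_append_drop i w, List.count_append] at h1
      simp only [List.count_append, List.count_replicate, Finset.mem_insert, beq_iff_eq]
      by_cases hk : k = N
      · subst hk
        rw [if_neg hNA] at h1
        simp; omega
      · simp [hk, Ne.symm hk]
        omega
    · refine isStirlingWord_append_replicate hm
        (fun l hl => hlt w hw l (List.mem_of_mem_take hl))
        (fun l hl => hlt w hw l (List.mem_of_mem_drop hl)) ?_
      rw [List.take_append_drop]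
      exact hw'.2
  · rintro ⟨w, i⟩ hx ⟨w', i'⟩ hx' h
    rw [Finset.mem_sigma, Finset.mem_range] at hx hx'
    simp only at hx hx' h
    have hn := hnot w hx.1
    have hn' := hnot w' hx'.1
    have h1 : N ∉ w.take i := fun h => hn (List.mem_of_mem_take h)
    have h2 : N ∉ w.drop i := fun h => hn (List.mem_of_mem_drop h)
    have h1' : N ∉ w'.take i' := fun h => hn' (List.mem_of_mem_take h)
    have h2' : N ∉ w'.drop i' := fun h => hn' (List.mem_of_mem_drop h)
    have e1 := congrArg (List.filter (· ≠ N)) h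
    rw [filter_ne_append_replicate h1 h2, filter_ne_append_replicate h1' h2',
      List.take_append_drop, List.take_append_drop] at e1
    have e2 := congrArg (List.takeWhile (· ≠ N)) h
    rw [takeWhile_ne_append_replicate hm h1, takeWhile_ne_append_replicate hm h1'] at e2
    have e3 := congrArg List.length e2
    rw [List.length_take, List.length_take] at e3
    subst e1
    have : i = i' := by omega
    rw [this]
  · intro w hw
    have hw' := mem_stirlingWords.1 hw
    obtain ⟨u, v, hu, hv, rfl⟩ := exists_eq_append_replicate (N := N) hm (fun l hl => by
        have := mem_of_mem_stirlingWords hw hl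
        rcases Finset.mem_insert.1 this with h | h
        · exact h.le
        · exact (hN l h).le) (by simpa using hw'.1 N) hw'.2
    refine ⟨⟨u ++ v, u.length⟩, ?_, by simp⟩
    rw [Finset.mem_sigma]
    refine ⟨mem_stirlingWords.2 ⟨fun k => ?_, ?_⟩, by simp⟩
    · have := hw'.1 k
      simp only [List.count_append, List.count_replicate, Finset.mem_insert, beq_iff_eq] at this ⊢
      by_cases hk : k = N
      · subst hk
        simp [hNA, List.count_eq_zero.2 hu, List.count_eq_zero.2 hv]
      · simp [hk, Ne.symm hk] at this
        exact this
    · intro a b hab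
      refine hw'.2 a b (hab.trans ?_)
      rw [List.append_assoc]
      exact (List.sublist_append_right _ _).append_left _
  · intro x _
    rfl

/-! #### Local structure of Stirling words -/

theorem three_le_count_of_letterAt {w : List α} {i j l : ℕ} {k : α} (hij : i < j) (hjl : j < l)
    (hi : letterAt w i = k) (hj : letterAt w j = k) (hl : letterAt w l = k) :
    3 ≤ w.count k := by
  obtain ⟨i, hi', rfl, ei⟩ := exists_of_letterAt_eq_coe hi
  obtain ⟨j, hj', rfl, ej⟩ := exists_of_letterAt_eq_coe hj
  obtain ⟨l, hl', rfl, el⟩ := exists_of_letterAt_eq_coe hl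
  rw [← List.replicate_sublist_iff]
  exact triple_sublist_iff.2 ⟨⟨i, hi'⟩, ⟨j, hj'⟩, ⟨l, hl'⟩, by simpa using hij, by simpa using hjl,
    ei, ej, el⟩

theorem two_le_count_of_letterAt {w : List α} {i j : ℕ} {k : α} (hij : i < j)
    (hi : letterAt w i = k) (hj : letterAt w j = k) : 2 ≤ w.count k := by
  obtain ⟨i, hi', rfl, ei⟩ := exists_of_letterAt_eq_coe hi
  obtain ⟨j, hj', rfl, ej⟩ := exists_of_letterAt_eq_coe hj
  rw [← List.duplicate_iff_two_le_count, List.duplicate_iff_exists_distinct_get]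
  exact ⟨⟨i, hi'⟩, ⟨j, hj'⟩, by simpa using hij, ei.symm, ej.symm⟩

theorem IsStirlingWord.le_letterAt {w : List α} (hw : IsStirlingWord w) {i j l : ℕ} {k : α}
    (hij : i < j) (hjl : j < l) (hi : letterAt w i = k) (hl : letterAt w l = k) :
    k ≤ letterAt w j := by
  obtain ⟨i, hi', rfl, ei⟩ := exists_of_letterAt_eq_coe hi
  obtain ⟨l, hl', rfl, el⟩ := exists_of_letterAt_eq_coe hl
  cases j with
  | zero => omega
  | succ j =>
    rw [letterAt_succ_of_lt (by omega)]
    exact WithBot.coe_le_coe.2 (hw k _ (triple_sublist_iff.2 ⟨⟨i, hi'⟩, ⟨j, by omega⟩, ⟨l, hl'⟩,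
      by simpa using hij, by simpa using hjl, ei, rfl, el⟩))

theorem locallyStirlingAt_of_mem {m : α → ℕ} (hm : ∀ k, m k = 1 ∨ m k = 2) {A : Finset α}
    {w : List α} (hw : w ∈ stirlingWords m A) {i : ℕ} (hi : i < w.length) :
    LocallyStirlingAt m (letterAt w i) (letterAt w (i + 1)) (letterAt w (i + 2)) := by
  obtain ⟨hc, hs⟩ := mem_stirlingWords.1 hw
  have hcount : w.count w[i] = m w[i] := by
    rw [hc, if_pos (mem_of_mem_stirlingWords hw (List.getElem_mem hi))]
  have hi1 := letterAt_succ_of_lt hi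
  refine ⟨fun h => ?_, fun h1 h2 => ?_, fun h => ?_⟩
  · have := two_le_count_of_letterAt (i := i + 1) (j := i + 2) (by omega) hi1 (h ▸ hi1)
    exact ⟨w[i], hi1, by omega⟩
  · rintro ⟨k, hk, hmk⟩
    obtain rfl : k = w[i] := WithBot.coe_injective (hk.symm.trans hi1)
    rw [hi1] at h1 h2
    have hd : 2 ≤ w.count w[i] := by omega
    rw [← List.duplicate_iff_two_le_count, List.duplicate_iff_exists_distinct_get] at hd
    obtain ⟨⟨r, hr⟩, ⟨s, hs'⟩, hrs, er, es⟩ := hd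
    have hrs : r < s := by simpa using hrs
    have er' : letterAt w (r + 1) = w[i] := by rw [letterAt_succ_of_lt hr]; exact congrArg _ er.symm
    have es' : letterAt w (s + 1) = w[i] := by rw [letterAt_succ_of_lt hs']; exact congrArg _ es.symm
    -- A multiple letter cannot be a peak: on the side of its other copy, the neighbour is either
    -- that copy or lies between the two copies, so it is not smaller.
    by_cases hri : r < i
    · have hne : r + 1 ≠ i := by rintro rfl; exact h1.ne er'
      exact absurd h1 (hs.le_letterAt (i := r + 1) (j := i) (l := i + 1) (by omega) (by omega)
        er' hi1).not_gt
    · have hne : s + 1 ≠ i + 2 := by intro h; rw [h] at es'; exact h2.ne es'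
      exact absurd h2 (hs.le_letterAt (i := i + 1) (j := i + 2) (l := s + 1) (by omega) (by omega)
        hi1 es').not_gt
  · have := three_le_count_of_letterAt (i := i) (j := i + 1) (l := i + 2) (by omega) (by omega)
      (h.1.trans hi1) hi1 (h.2 ▸ hi1)
    have := hm w[i]
    omega

theorem locallyStirling_of_mem {m : α → ℕ} (hm : ∀ k, m k = 1 ∨ m k = 2) {A : Finset α}
    {w : List α} (hw : w ∈ stirlingWords m A) : LocallyStirling m ⊥ w := by
  refine locallyStirling_of_forall fun i hi => ?_
  rw [← letterAt_eq_letterFrom]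
  exact locallyStirlingAt_of_mem hm hw hi

end Words

/-! ### Weight sums over Stirling words -/

section Sums

variable {α : Type*} [LinearOrder α] {R : Type*} [CommRing R]

/-- The weight of a word as the product of the weights of its letters, where the empty word has
the weight `z`. -/
noncomputable def wordWeight (m : α → ℕ) (a c d z : R) : List α → R
  | [] => z
  | k :: w => tripleProd m a c d z ⊥ (k :: w)

theorem wordWeight_of_ne_nil (m : α → ℕ) (a c d z : R) {w : List α} (hw : w ≠ []) :
    wordWeight m a c d z w = tripleProd m a c d z ⊥ w := by
  cases w with
  | nil => exact absurd rfl hw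
  | cons k w => rfl

theorem insertionSum_wordWeight {m : α → ℕ} {a c d z : R} {N : α} {j : ℕ} (hj : j = 1 ∨ j = 2)
    (D : Derivation ℤ R R) (ha : D a = c + d) (hc : D c = 1) (hd : D d = 1) (hz : D z = 1)
    {w : List α} (hN : ∀ l ∈ w, l < N) (hw : LocallyStirling m ⊥ w) :
    insertionSum (wordWeight m a c d z) (List.replicate j N) w =
      a * z ^ (j - 1) * D (wordWeight m a c d z w) := by
  have hne : ∀ u v : List α, u ++ List.replicate j N ++ v ≠ [] := fun u v h => by
    rcases hj with rfl | rfl <;> simp at h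
  have h : insertionSum (wordWeight m a c d z) (List.replicate j N) w =
      insertionSum (tripleProd m a c d z ⊥) (List.replicate j N) w :=
    Finset.sum_congr rfl fun i _ => wordWeight_of_ne_nil _ _ _ _ _ (hne _ _)
  rw [h]
  -- The empty word has a single gap, a plateau between two boundary letters; its weight z makes the
  -- recurrence hold from the start, since Dz = 1.
  by_cases hw0 : w = []
  · subst hw0
    have := tripleProd_replicate_append m a c d z hj ⊥ [] (WithBot.bot_lt_coe N) (by simp)
    simpa [insertionSum, wordWeight, hz, tripleProd] using this
  · rw [wordWeight_of_ne_nil _ _ _ _ _ hw0]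
    exact insertionSum_tripleProd D ha hc hd hz (firstLetter_replicate_one_or_two N hj)
      (tripleProd_replicate_append m a c d z hj) hN hw hw0

theorem sum_wordWeight_insert {m : α → ℕ} (hm : ∀ k, m k = 1 ∨ m k = 2) {a c d z : R}
    (D : Derivation ℤ R R) (ha : D a = c + d) (hc : D c = 1) (hd : D d = 1) (hz : D z = 1)
    {A : Finset α} {N : α} (hN : ∀ k ∈ A, k < N) :
    ∑ w ∈ stirlingWords m (insert N A), wordWeight m a c d z w =
      a * z ^ (m N - 1) * D (∑ w ∈ stirlingWords m A, wordWeight m a c d z w) := by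
  rw [sum_stirlingWords_insert (hm N) hN, map_sum, Finset.mul_sum]
  exact Finset.sum_congr rfl fun w hw => insertionSum_wordWeight (hm N) D ha hc hd hz
    (fun l hl => hN l (mem_of_mem_stirlingWords hw hl)) (locallyStirling_of_mem hm hw)

theorem sum_edgeProd_insert {m : α → ℕ} (hm : ∀ k, m k = 1 ∨ m k = 2) {x y z : R}
    (D : Derivation ℤ R R) (hx : D x = 1) (hy : D y = 1) (hz : D z = 1)
    {A : Finset α} {N : α} (hN : ∀ k ∈ A, k < N) :
    ∑ w ∈ stirlingWords m (insert N A), edgeProd x y z ⊥ w =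
      x * y * z ^ (m N - 1) * D (∑ w ∈ stirlingWords m A, edgeProd x y z ⊥ w) := by
  rw [sum_stirlingWords_insert (hm N) hN, map_sum, Finset.mul_sum]
  exact Finset.sum_congr rfl fun w hw => insertionSum_edgeProd D hx hy hz
    (edgeProd_replicate_append x y z (hm N)) (WithBot.bot_lt_coe N)
    (fun l hl => hN l (mem_of_mem_stirlingWords hw hl))

theorem sum_edgeProd_eq_sum_wordWeight {m : α → ℕ} (hm : ∀ k, m k = 1 ∨ m k = 2)
    (A : Finset α) {x y z : R} (D : Derivation ℤ R R) (hx : D x = 1) (hy : D y = 1)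
    (hz : D z = 1) :
    ∑ w ∈ stirlingWords m A, edgeProd x y z ⊥ w =
      ∑ w ∈ stirlingWords m A, wordWeight m (x * y) x y z w := by
  induction A using Finset.induction_on_max with
  | empty => simp [stirlingWords_empty, wordWeight, edgeProd, edgeWeight]
  | insert N A hN ih =>
    rw [sum_edgeProd_insert hm D hx hy hz hN,
      sum_wordWeight_insert hm D (by simp [hx, hy]) hx hy hz hN, ih]

/-! ### Dependence on c and d only through c + d -/

/-- The derivation of `ℤ[a, v, z]` with `a ↦ v`, `v ↦ 2`, `z ↦ 1`. -/
noncomputable def gammaDerivation :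
    Derivation ℤ (MvPolynomial (Fin 3) ℤ) (MvPolynomial (Fin 3) ℤ) :=
  mkDerivation ℤ ![X 1, 2, 1]

theorem derivation_eval₂Hom {a c d z : R} (D : Derivation ℤ R R) (ha : D a = c + d) (hc : D c = 1)
    (hd : D d = 1) (hz : D z = 1) (G : MvPolynomial (Fin 3) ℤ) :
    D (eval₂Hom (Int.castRingHom R) ![a, c + d, z] G) =
      eval₂Hom (Int.castRingHom R) ![a, c + d, z] (gammaDerivation G) := by
  induction G using MvPolynomial.induction_on with
  | C r => simp [gammaDerivation]
  | add p q hp hq => simp only [map_add, hp, hq]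
  | mul_X p i hp =>
    have hi : D (eval₂Hom (Int.castRingHom R) ![a, c + d, z] (X i : MvPolynomial (Fin 3) ℤ)) =
        eval₂Hom (Int.castRingHom R) ![a, c + d, z] (gammaDerivation (X i)) := by
      fin_cases i
      · simp [gammaDerivation, ha]
      · simp [gammaDerivation, hc, hd]
        norm_num
      · simp [gammaDerivation, hz]
    simp only [map_mul, map_add, Derivation.leibniz, smul_eq_mul, hp, hi]

theorem exists_sum_wordWeight_eq_eval₂Hom {m : α → ℕ} (hm : ∀ k, m k = 1 ∨ m k = 2)
    (A : Finset α) {a c d z : R}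
    (D : Derivation ℤ R R) (ha : D a = c + d) (hc : D c = 1) (hd : D d = 1) (hz : D z = 1) :
    ∃ G : MvPolynomial (Fin 3) ℤ,
      ∑ w ∈ stirlingWords m A, wordWeight m a c d z w =
        eval₂Hom (Int.castRingHom R) ![a, c + d, z] G := by
  induction A using Finset.induction_on_max with
  | empty => exact ⟨X 2, by simp [stirlingWords_empty, wordWeight]⟩
  | insert N A hN ih =>
    obtain ⟨G, hG⟩ := ih
    refine ⟨X 0 * X 2 ^ (m N - 1) * gammaDerivation G, ?_⟩
    rw [sum_wordWeight_insert hm D ha hc hd hz hN, hG, derivation_eval₂Hom D ha hc hd hz]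
    simp

theorem map_tripleProd {R' : Type*} [CommRing R'] (f : R →+* R') (m : α → ℕ) (a c d z : R)
    (p : WithBot α) (w : List α) :
    f (tripleProd m a c d z p w) = tripleProd m (f a) (f c) (f d) (f z) p w := by
  induction w generalizing p with
  | nil => simp [tripleProd]
  | cons k w ih =>
    rw [tripleProd, tripleProd, map_mul, ih]
    congr 1
    unfold tripleWeight
    split_ifs <;> simp

theorem map_wordWeight {R' : Type*} [CommRing R'] (f : R →+* R') (m : α → ℕ) (a c d z : R)
    (w : List α) :
    f (wordWeight m a c d z w) = wordWeight m (f a) (f c) (f d) (f z) w := by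
  cases w with
  | nil => rfl
  | cons k w => exact map_tripleProd f m a c d z ⊥ (k :: w)

/-- A derivation with the required values need not exist on `R`, and cannot send d = 0 to 1. The
identity is therefore obtained for four independent variables and then specialised. -/
theorem sum_wordWeight_add_zero {m : α → ℕ} (hm : ∀ k, m k = 1 ∨ m k = 2)
    (A : Finset α) (a c d z : R) :
    ∑ w ∈ stirlingWords m A, wordWeight m a c d z w =
      ∑ w ∈ stirlingWords m A, wordWeight m a (c + d) 0 z w := by
  obtain ⟨G, hG⟩ := exists_sum_wordWeight_eq_eval₂Hom (R := MvPolynomial (Fin 4) ℤ) hm A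
    (a := X 0) (c := X 1) (d := X 2) (z := X 3) (mkDerivation ℤ ![X 1 + X 2, 1, 1, 1])
    (by exact mkDerivation_X ℤ _ 0) (by exact mkDerivation_X ℤ _ 1)
    (by exact mkDerivation_X ℤ _ 2) (by exact mkDerivation_X ℤ _ 3)
  have key : ∀ a c d z : R, ∑ w ∈ stirlingWords m A, wordWeight m a c d z w =
      eval₂Hom (Int.castRingHom R) ![a, c + d, z] G := fun a c d z => by
    have h := congrArg (eval₂Hom (Int.castRingHom R) ![a, c, d, z]) hG
    have e : (eval₂Hom (Int.castRingHom R) ![a, c, d, z]).comp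
        (eval₂Hom (Int.castRingHom (MvPolynomial (Fin 4) ℤ)) ![X 0, X 1 + X 2, X 3]) =
          eval₂Hom (Int.castRingHom R) ![a, c + d, z] := by
      refine MvPolynomial.ringHom_ext (fun r => by simp) fun i => ?_
      fin_cases i <;> simp
    rw [← e, RingHom.comp_apply, ← h, map_sum]
    refine Finset.sum_congr rfl fun w _ => ?_
    rw [map_wordWeight]
    simp
  rw [key, key, add_zero]

/-! ### Statistics as exponents -/

/-- Switches from ascent to non-ascent (weight a) alternate with switches back (weight 1). As the
word ends in a non-ascent, the former exceed the latter by one exactly when it starts with an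
ascent. -/
theorem tripleProd_pow_length (m : α → ℕ) (t : R) (p : WithBot α) (w : List α) :
    tripleProd m (t ^ 2) t t t p w = t ^ (w.length + if p < firstLetter w then 1 else 0) := by
  induction w generalizing p with
  | nil => simp [tripleProd, firstLetter]
  | cons k w ih =>
    rw [tripleProd, ih, firstLetter_cons, List.length_cons]
    unfold tripleWeight
    split_ifs <;> ring

/-- A word that starts with an ascent must at some letter stop ascending, and that letter has weight
a = 0. -/
theorem tripleProd_zero_one (m : α → ℕ) {p : WithBot α} {w : List α} (h : p < firstLetter w) :
    tripleProd m (0 : R) 1 1 1 p w = 0 := by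
  induction w generalizing p with
  | nil => exact absurd h not_lt_bot
  | cons k w ih =>
    rw [firstLetter_cons] at h
    rw [tripleProd, tripleWeight, if_pos h]
    split_ifs with hk
    · rw [ih hk, mul_zero]
    · rw [zero_mul]

theorem pow_card_filter_Icc (t : R) (P : ℕ → Prop) [DecidablePred P] (n : ℕ) :
    t ^ ((Finset.Icc 1 n).filter P).card =
      ∏ i ∈ Finset.range n, if P (i + 1) then t else 1 := by
  rw [← Finset.prod_const, Finset.prod_filter, ← Finset.Ico_add_one_right_eq_Icc,
    Finset.prod_Ico_eq_prod_range]
  simp [add_comm]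

theorem pow_card_filter_range (t : R) (P : ℕ → Prop) [DecidablePred P] (n : ℕ) :
    t ^ ((Finset.range n).filter P).card = ∏ i ∈ Finset.range n, if P i then t else 1 := by
  rw [← Finset.prod_const, Finset.prod_filter]

theorem pow_stat_eq_edgeProd (x y z : R) (w : List α) :
    x ^ asc w * y ^ des w * z ^ plat w = edgeProd x y z ⊥ w := by
  rw [asc, des, plat, pow_card_filter_range, pow_card_filter_range, pow_card_filter_range,
    ← Finset.prod_mul_distrib, ← Finset.prod_mul_distrib, edgeProd_eq_prod,
    ← letterAt_eq_letterFrom]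
  refine Finset.prod_congr rfl fun i _ => ?_
  rcases lt_trichotomy (letterAt w i) (letterAt w (i + 1)) with h | h | h
  · simp [edgeWeight, h, h.not_gt, h.ne]
  · simp [edgeWeight, h]
  · simp [edgeWeight, h, h.not_gt, h.ne']

theorem statPoly_eq_sum_edgeProd (W : Finset (List α)) :
    statPoly W = ∑ w ∈ W, edgeProd (X 0) (X 1) (X 2) ⊥ w :=
  Finset.sum_congr rfl fun w _ => pow_stat_eq_edgeProd _ _ _ w

end Sums

/-! ### The γ-expansion for generalized Stirling permutations -/

section Gamma

variable {R : Type*} [CommRing R] {N : ℕ} {m : Fin N → ℕ}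

theorem genStirlingSet_eq_stirlingWords (m : Fin N → ℕ) :
    genStirlingSet m = stirlingWords m Finset.univ := by
  classical
  ext w
  rw [genStirlingSet, stirlingWords, Finset.mem_filter, Finset.mem_filter, isStirlingWord_iff]
  rfl

open Classical in
/-- Number of double ascents. -/
noncomputable def dasc (w : List (Fin N)) : ℕ :=
  ((Finset.Icc 1 w.length).filter fun i =>
    letterAt w (i - 1) < letterAt w i ∧ letterAt w i < letterAt w (i + 1)).card

/-- An earlier occurrence of the plateau letter would be a third copy. -/
theorem isFreeDescentPlateau_iff (hm : ∀ k, m k = 1 ∨ m k = 2) {A : Finset (Fin N)}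
    {w : List (Fin N)} (hw : w ∈ stirlingWords m A) {i : ℕ} (hi : i < w.length) :
    IsFreeDescentPlateau w (i + 1) ↔
      letterAt w (i + 1) < letterAt w i ∧ letterAt w (i + 1) = letterAt w (i + 2) := by
  refine ⟨fun h => ⟨h.1, h.2.1⟩, fun h => ⟨h.1, h.2, fun l hl hli => ?_⟩⟩
  rw [Finset.mem_Icc] at hl
  have hi1 := letterAt_succ_of_lt hi
  have h3 := three_le_count_of_letterAt (i := l) (j := i + 1) (l := i + 2) (by omega) (by omega)
    (hli.trans hi1) hi1 (h.2 ▸ hi1)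
  rw [(mem_stirlingWords.1 hw).1] at h3
  have := hm w[i]
  split_ifs at h3 <;> omega

theorem tripleProd_eq_pow_stat (hm : ∀ k, m k = 1 ∨ m k = 2) {A : Finset (Fin N)}
    {w : List (Fin N)} (hw : w ∈ stirlingWords m A) (a c d z : R) :
    tripleProd m a c d z ⊥ w =
      a ^ ascpp w * c ^ dasc w * (d ^ sddes m w * d ^ fdesp w) * z ^ mdup m w := by
  classical
  rw [ascpp, dasc, sddes, fdesp, mdup]
  simp only [pow_card_filter_Icc]
  rw [← Finset.prod_mul_distrib, ← Finset.prod_mul_distrib, ← Finset.prod_mul_distrib,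
    ← Finset.prod_mul_distrib, tripleProd_eq_prod, ← letterAt_eq_letterFrom]
  refine Finset.prod_congr rfl fun i hi => ?_
  rw [Finset.mem_range] at hi
  have hfree := isFreeDescentPlateau_iff hm hw hi
  obtain ⟨h1, h2, h3⟩ := locallyStirlingAt_of_mem hm hw hi
  have hsing : IsSingleAt m w (i + 1) ↔ ¬ IsMultipleLetter m (letterAt w (i + 1)) := by
    have hi1 := letterAt_succ_of_lt hi
    constructor
    · rintro ⟨k, hk, hk'⟩ ⟨l, hl, hl'⟩
      exact hk' (WithBot.coe_injective (hk.symm.trans hl) ▸ hl')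
    · exact fun h => ⟨_, hi1, fun h' => h ⟨_, hi1, h'⟩⟩
  -- A descent following a plateau thus counts in `mdup`, in agreement with its weight z.
  have h0 : letterAt w i = letterAt w (i + 1) → IsMultipleLetter m (letterAt w (i + 1)) := by
    intro h
    have hi1 := letterAt_succ_of_lt hi
    have h2 := two_le_count_of_letterAt (i := i) (j := i + 1) (by omega) (h.trans hi1) hi1
    rw [(mem_stirlingWords.1 hw).1] at h2
    exact ⟨w[i], hi1, by split_ifs at h2 <;> omega⟩
  have hmult : IsMultipleAt m w (i + 1) ↔ IsMultipleLetter m (letterAt w (i + 1)) := Iff.rfl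
  simp only [IsUnmovablePlateau, hfree, hsing, hmult, IsAscentPlateau, IsPeak,
    Nat.add_sub_cancel, tripleWeight, add_assoc, Nat.reduceAdd]
  generalize letterAt w i = p at *
  generalize letterAt w (i + 1) = k at *
  generalize letterAt w (i + 2) = q at *
  rcases lt_trichotomy p k with hp | hp | hp <;> rcases lt_trichotomy k q with hq | hq | hq <;>
    by_cases hk : IsMultipleLetter m k <;>
    simp_all [LT.lt.not_gt, LT.lt.ne, LT.lt.ne']

theorem ne_nil_of_mem_stirlingWords (hm : ∀ k, m k = 1 ∨ m k = 2) {A : Finset (Fin N)}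
    (hA : A.Nonempty) {w : List (Fin N)} (hw : w ∈ stirlingWords m A) : w ≠ [] := by
  rintro rfl
  obtain ⟨k, hk⟩ := hA
  have := (mem_stirlingWords.1 hw).1 k
  rw [if_pos hk, List.count_nil] at this
  have := hm k
  omega

theorem bot_lt_firstLetter {w : List (Fin N)} (hw : w ≠ []) : ⊥ < firstLetter w := by
  cases w with
  | nil => exact absurd rfl hw
  | cons k w => exact WithBot.bot_lt_coe k

theorem stat_sum_eq_length_add_one (hm : ∀ k, m k = 1 ∨ m k = 2) {A : Finset (Fin N)}
    (hA : A.Nonempty) {w : List (Fin N)} (hw : w ∈ stirlingWords m A) :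
    2 * ascpp w + dasc w + (sddes m w + fdesp w) + mdup m w = w.length + 1 := by
  have h := tripleProd_pow_length m (Polynomial.X : Polynomial ℤ) ⊥ w
  rw [tripleProd_eq_pow_stat hm hw,
    if_pos (bot_lt_firstLetter (ne_nil_of_mem_stirlingWords hm hA hw)), ← pow_mul, ← pow_add,
    ← pow_add, ← pow_add, ← pow_add] at h
  have := congrArg Polynomial.natDegree h
  simpa only [Polynomial.natDegree_X_pow] using this

theorem ascpp_pos (hm : ∀ k, m k = 1 ∨ m k = 2) {A : Finset (Fin N)}
    (hA : A.Nonempty) {w : List (Fin N)} (hw : w ∈ stirlingWords m A) : 0 < ascpp w := by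
  have h := tripleProd_zero_one (R := ℤ) m
    (bot_lt_firstLetter (ne_nil_of_mem_stirlingWords hm hA hw))
  rw [tripleProd_eq_pow_stat hm hw] at h
  by_contra h0
  rw [Nat.eq_zero_of_not_pos h0] at h
  simp at h

theorem length_of_mem_stirlingWords_univ {w : List (Fin N)}
    (hw : w ∈ stirlingWords m Finset.univ) : w.length = ∑ k, m k := by
  rw [← Multiset.coe_card, ← Multiset.sum_count_eq_card (s := Finset.univ) (by simp)]
  exact Finset.sum_congr rfl fun k _ => by simp [(mem_stirlingWords.1 hw).1 k]

/-- The `γ`-expansion of the generating function of generalized Stirling permutations whose letters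
have multiplicities one or two. -/
theorem statPoly_genStirlingSet_eq [NeZero N] (hm : ∀ k, m k = 1 ∨ m k = 2) {M : ℕ}
    (hM : ∑ k, m k = M) :
    statPoly (genStirlingSet m) =
      ∑ k ∈ Finset.range M, X 2 ^ k *
        ∑ j ∈ Finset.Icc 1 ((M + 1 - k) / 2),
          C (stirlingGamma m k j : ℤ) * (X 0 * X 1) ^ j * (X 0 + X 1) ^ (M + 1 - k - 2 * j) := by
  classical
  have hu : (Finset.univ : Finset (Fin N)).Nonempty := ⟨0, Finset.mem_univ 0⟩
  have hγ : ∀ k j, (C (stirlingGamma m k j : ℤ) : MvPolynomial (Fin 3) ℤ) =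
      ∑ w ∈ stirlingWords m Finset.univ,
        if sddes m w = 0 ∧ fdesp w = 0 ∧ mdup m w = k ∧ ascpp w = j then 1 else 0 := by
    intro k j
    rw [Finset.sum_boole, stirlingGamma, genStirlingSet_eq_stirlingWords]
    simp
  have hterm : ∀ w ∈ stirlingWords m Finset.univ,
      wordWeight m (X 0 * X 1) (X 0 + X 1) 0 (X 2 : MvPolynomial (Fin 3) ℤ) w =
      ∑ k ∈ Finset.range M, ∑ j ∈ Finset.Icc 1 ((M + 1 - k) / 2),
        if sddes m w = 0 ∧ fdesp w = 0 ∧ mdup m w = k ∧ ascpp w = j then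
          X 2 ^ k * ((X 0 * X 1) ^ j * (X 0 + X 1) ^ (M + 1 - k - 2 * j)) else 0 := by
    intro w hw
    have hlen := (length_of_mem_stirlingWords_univ hw).trans hM
    have hsum := stat_sum_eq_length_add_one hm hu hw
    have hpos := ascpp_pos hm hu hw
    rw [wordWeight_of_ne_nil _ _ _ _ _ (ne_nil_of_mem_stirlingWords hm hu hw),
      tripleProd_eq_pow_stat hm hw, ← pow_add]
    by_cases h0 : sddes m w = 0 ∧ fdesp w = 0
    -- The index ranges suffice because `ascpp` is positive and `2 * ascpp w + mdup m w ≤ M + 1`.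
    · rw [Finset.sum_eq_single_of_mem (mdup m w) (Finset.mem_range.2 (by omega))
        (fun k _ hk => Finset.sum_eq_zero fun j _ => if_neg fun h => hk h.2.2.1.symm),
        Finset.sum_eq_single_of_mem (ascpp w) (Finset.mem_Icc.2 (by omega))
        (fun j _ hj => if_neg fun h => hj h.2.2.2.symm), if_pos ⟨h0.1, h0.2, rfl, rfl⟩, h0.1, h0.2]
      have : dasc w = M + 1 - mdup m w - 2 * ascpp w := by omega
      rw [this]
      ring
    · rw [Finset.sum_eq_zero fun k _ => Finset.sum_eq_zero fun j _ =>
        if_neg fun h => h0 ⟨h.1, h.2.1⟩, zero_pow (by omega)]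
      ring
  rw [statPoly_eq_sum_edgeProd, genStirlingSet_eq_stirlingWords,
    -- The derivation is ∂/∂x + ∂/∂y + ∂/∂z.
    sum_edgeProd_eq_sum_wordWeight hm Finset.univ (mkDerivation ℤ fun _ => 1)
      (by exact mkDerivation_X ℤ _ 0) (by exact mkDerivation_X ℤ _ 1)
      (by exact mkDerivation_X ℤ _ 2),
    sum_wordWeight_add_zero hm, Finset.sum_congr rfl hterm, Finset.sum_comm]
  refine Finset.sum_congr rfl fun k _ => ?_
  rw [Finset.sum_comm, Finset.mul_sum]
  refine Finset.sum_congr rfl fun j _ => ?_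
  rw [hγ, mul_assoc, Finset.sum_mul, Finset.mul_sum]
  refine Finset.sum_congr rfl fun w _ => ?_
  split_ifs <;> ring

end Gamma

/-! ### Relabelling the alphabet -/

theorem exists_map_eq_of_forall_mem {α β : Type*} {e : β → α} {w : List α}
    (h : ∀ k ∈ w, ∃ l, e l = k) :
    ∃ v : List β, v.map e = w := by
  induction w with
  | nil => exact ⟨[], rfl⟩
  | cons k w ih =>
    obtain ⟨v, rfl⟩ := ih fun l hl => h l (by simp [hl])
    obtain ⟨l, rfl⟩ := h k (by simp)
    exact ⟨l :: v, rfl⟩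

section Relabel

variable {α β : Type*} [LinearOrder α] [LinearOrder β] {R : Type*} [CommRing R]

theorem edgeProd_map (e : β ↪o α) (x y z : R) (p : WithBot β) (w : List β) :
    edgeProd x y z (p.map e) (w.map e) = edgeProd x y z p w := by
  have hlt : ∀ p q : WithBot β, p.map e < q.map e ↔ p < q := fun p q =>
    (e.strictMono.withBot_map).lt_iff_lt
  induction w generalizing p with
  | nil =>
    have := hlt p ⊥
    have h' := hlt ⊥ p
    rw [WithBot.map_bot] at this h'
    simp only [List.map_nil, edgeProd, edgeWeight, this, h']
  | cons k w ih =>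
    have h1 := hlt p k
    have h2 := hlt k p
    rw [WithBot.map_coe] at h1 h2
    have := ih k
    rw [WithBot.map_coe] at this
    simp only [List.map_cons, edgeProd, edgeWeight, h1, h2, this]

theorem isStirlingWord_map_iff (e : β ↪o α) {w : List β} :
    IsStirlingWord (w.map e) ↔ IsStirlingWord w := by
  constructor
  · intro h a b hab
    exact e.le_iff_le.1 (h (e a) (e b) (hab.map e))
  · intro h a b hab
    obtain ⟨l, hl, he⟩ := List.sublist_map_iff.1 hab
    obtain ⟨a', b', c', rfl⟩ := List.length_eq_three.1
      (show l.length = 3 by simpa using (congrArg List.length he).symm)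
    simp only [List.map_cons, List.map_nil, List.cons.injEq, and_true] at he
    obtain ⟨rfl, rfl, h3⟩ := he
    obtain rfl := e.injective h3
    exact e.le_iff_le.2 (h _ _ hl)

theorem map_mem_stirlingWords_iff [Fintype β] (e : β ↪o α) {m : α → ℕ} {w : List β} :
    w.map e ∈ stirlingWords m (Finset.univ.map e.toEmbedding) ↔
      w ∈ stirlingWords (m ∘ e) Finset.univ := by
  rw [mem_stirlingWords, mem_stirlingWords, isStirlingWord_map_iff]
  refine and_congr_left fun _ => ⟨fun h k => ?_, fun h k => ?_⟩
  · have := h (e k)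
    rw [List.count_map_of_injective _ _ e.injective] at this
    simpa using this
  · by_cases hk : ∃ l, e l = k
    · obtain ⟨l, rfl⟩ := hk
      rw [List.count_map_of_injective _ _ e.injective, h]
      simp
    · have h1 : k ∉ w.map e := fun h => by
        obtain ⟨l, -, hl⟩ := List.mem_map.1 h
        exact hk ⟨l, hl⟩
      rw [List.count_eq_zero.2 h1, if_neg]
      simpa using hk

theorem statPoly_stirlingWords_map [Fintype β] (e : β ↪o α) (m : α → ℕ) :
    statPoly (stirlingWords m (Finset.univ.map e.toEmbedding)) =
      statPoly (stirlingWords (m ∘ e) Finset.univ) := by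
  rw [statPoly_eq_sum_edgeProd, statPoly_eq_sum_edgeProd]
  symm
  refine Finset.sum_bij (fun w _ => w.map e) (fun w hw => (map_mem_stirlingWords_iff e).2 hw)
    (fun w _ w' _ h => List.map_injective_iff.2 e.injective h) (fun w hw => ?_)
    (fun w _ => (edgeProd_map e _ _ _ ⊥ w).symm)
  obtain ⟨v, rfl⟩ := exists_map_eq_of_forall_mem (e := e) (w := w) fun k hk => by
    simpa using mem_of_mem_stirlingWords hw hk
  exact ⟨v, (map_mem_stirlingWords_iff e).1 hw, rfl⟩

theorem card_filter_lt_orderEmb {N : ℕ} (e : Fin N ↪o α) (l : Fin N) :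
    ((Finset.univ.map e.toEmbedding).filter (· < e l)).card = l := by
  rw [Finset.filter_map, Finset.card_map]
  simp [Finset.filter_gt_eq_Iio]

end Relabel

/-! ### Jacobi–Stirling permutations as Stirling words -/

section JacobiStirling

variable {n : ℕ}

/-- The letters of `M_{n,S}`. -/
def jsLetters (S : Finset (Fin n)) : Finset (JSLetter n) :=
  (Finset.univ.image unbarred) ∪ Sᶜ.image barred

/-- The multiplicities of the letters of `M_n`. -/
def jsMult (x : JSLetter n) : ℕ := if (ofLex x).2 then 2 else 1

theorem unbarred_injective : Function.Injective (unbarred (n := n)) := fun _ _ h =>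
  congrArg (fun x => (ofLex x).1) h

theorem barred_injective : Function.Injective (barred (n := n)) := fun _ _ h =>
  congrArg (fun x => (ofLex x).1) h

theorem barred_ne_unbarred (a b : Fin n) : barred a ≠ unbarred b := fun h =>
  Bool.false_ne_true (congrArg (fun x => (ofLex x).2) h)

theorem jsLetter_cases (x : JSLetter n) : (∃ a, x = unbarred a) ∨ ∃ a, x = barred a := by
  rcases h : ofLex x with ⟨a, b⟩
  cases b
  · exact Or.inr ⟨a, h⟩
  · exact Or.inl ⟨a, h⟩

theorem jsMult_unbarred (a : Fin n) : jsMult (unbarred a) = 2 := rfl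

theorem jsMult_barred (a : Fin n) : jsMult (barred a) = 1 := rfl

theorem jsMult_eq_one_or_two (x : JSLetter n) : jsMult x = 1 ∨ jsMult x = 2 := by
  unfold jsMult
  split_ifs <;> simp

theorem disjoint_image_unbarred_barred (s t : Finset (Fin n)) :
    Disjoint (s.image unbarred) (t.image barred) := by
  rw [Finset.disjoint_left]
  intro x hx hx'
  obtain ⟨a, -, rfl⟩ := Finset.mem_image.1 hx
  obtain ⟨b, -, hb⟩ := Finset.mem_image.1 hx'
  exact barred_ne_unbarred b a hb

theorem unbarred_mem_jsLetters (S : Finset (Fin n)) (a : Fin n) : unbarred a ∈ jsLetters S := by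
  simp [jsLetters]

theorem barred_mem_jsLetters {S : Finset (Fin n)} {a : Fin n} :
    barred a ∈ jsLetters S ↔ a ∉ S := by
  simp [jsLetters, barred_injective.eq_iff, (barred_ne_unbarred _ _).symm]

theorem count_jsFullMultiset (x : JSLetter n) :
    (jsFullMultiset n).count x = jsMult x := by
  rw [jsFullMultiset, Multiset.count_sum']
  rcases jsLetter_cases x with ⟨a, rfl⟩ | ⟨a, rfl⟩
  · rw [Finset.sum_eq_single a]
    · simp [jsMult_unbarred,
        (barred_ne_unbarred _ _).symm]
    · intro b _ hb
      simp [(barred_ne_unbarred _ _).symm,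
        unbarred_injective.eq_iff, hb.symm]
    · simp
  · rw [Finset.sum_eq_single a]
    · simp [jsMult_barred, barred_ne_unbarred]
    · intro b _ hb
      simp [barred_ne_unbarred,
        barred_injective.eq_iff, hb.symm]
    · simp

theorem count_jsMultiset (S : Finset (Fin n)) (x : JSLetter n) :
    (jsMultiset n S).count x = if x ∈ jsLetters S then jsMult x else 0 := by
  rw [jsMultiset, Multiset.count_sub, count_jsFullMultiset]
  rcases jsLetter_cases x with ⟨a, rfl⟩ | ⟨a, rfl⟩
  · rw [if_pos (unbarred_mem_jsLetters S a), Multiset.count_eq_zero.2, Nat.sub_zero]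
    intro h
    obtain ⟨b, -, hb⟩ := Multiset.mem_map.1 h
    exact barred_ne_unbarred b a hb
  · rw [Multiset.count_map_eq_count' _ _ barred_injective, jsMult_barred]
    by_cases ha : a ∈ S
    · rw [if_neg (by simpa [barred_mem_jsLetters] using ha), Multiset.count_eq_one_of_mem S.nodup ha]
    · rw [if_pos (barred_mem_jsLetters.2 ha), Multiset.count_eq_zero.2 ha]

/-- Barred letters occur at most once and impose no condition; for unbarred letters, equality in the
weak inequality would need a third copy. -/
theorem isJacobiStirling_iff {w : List (JSLetter n)} (h : ∀ x, w.count x ≤ jsMult x) :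
    IsJacobiStirling w ↔ IsStirlingWord w := by
  constructor
  · intro hw x y hxy
    rcases jsLetter_cases x with ⟨a, rfl⟩ | ⟨a, rfl⟩
    · obtain ⟨p, q, r, hpq, hqr, hp, rfl, hr⟩ := triple_sublist_iff.1 hxy
      exact (hw a p q r hpq hqr hp hr).le
    · have h1 := hxy.count_le (barred a)
      have h2 := h (barred a)
      rw [jsMult_barred] at h2
      by_cases hy : y = barred a
      · exact hy.ge
      · simp [hy] at h1
        omega
  · intro hw a p q r hpq hqr hp hr
    have hs : [unbarred a, w.get q, unbarred a].Sublist w :=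
      triple_sublist_iff.2 ⟨p, q, r, hpq, hqr, hp, rfl, hr⟩
    refine lt_of_le_of_ne (hw _ _ hs) fun he => ?_
    rw [← he] at hs
    have h1 := hs.count_le (unbarred a)
    have h2 := h (unbarred a)
    rw [jsMult_unbarred] at h2
    simp at h1
    omega

theorem jspSet_eq_stirlingWords (S : Finset (Fin n)) :
    jspSet n S = stirlingWords jsMult (jsLetters S) := by
  ext w
  rw [mem_jspSet, mem_stirlingWords, Multiset.ext]
  simp only [Multiset.coe_count, count_jsMultiset]
  refine and_congr_right fun h => isJacobiStirling_iff fun x => ?_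
  have hx : w.count x = if x ∈ jsLetters S then jsMult x else 0 := by
    convert h x
  rw [hx]
  split_ifs <;> simp

theorem card_jsLetters (S : Finset (Fin n)) : (jsLetters S).card = 2 * n - S.card := by
  have : S.card ≤ n := by simpa using S.card_le_univ
  rw [jsLetters, Finset.card_union_of_disjoint (disjoint_image_unbarred_barred _ _),
    Finset.card_image_of_injective _ unbarred_injective,
    Finset.card_image_of_injective _ barred_injective, Finset.card_compl, Finset.card_univ,
    Fintype.card_fin]
  omega

theorem sum_jsMult (S : Finset (Fin n)) : ∑ x ∈ jsLetters S, jsMult x = 3 * n - S.card := by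
  have : S.card ≤ n := by simpa using S.card_le_univ
  rw [jsLetters, Finset.sum_union (disjoint_image_unbarred_barred _ _),
    Finset.sum_image unbarred_injective.injOn, Finset.sum_image barred_injective.injOn]
  simp only [jsMult_unbarred, jsMult_barred, Finset.sum_const, Finset.card_compl, Finset.card_univ,
    Fintype.card_fin, smul_eq_mul]
  omega

theorem unbarred_lt_unbarred {a b : Fin n} : unbarred a < unbarred b ↔ a < b := by
  simp [unbarred, Prod.Lex.toLex_lt_toLex]

theorem barred_lt_unbarred {a b : Fin n} : barred a < unbarred b ↔ a ≤ b := by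
  simp [barred, unbarred, Prod.Lex.toLex_lt_toLex, le_iff_lt_or_eq]

theorem card_filter_lt_unbarred (S : Finset (Fin n)) (p : Fin n) :
    ((jsLetters S).filter (· < unbarred p)).card =
      p + ((Finset.univ \ S).filter (· ≤ p)).card := by
  rw [jsLetters, Finset.filter_union, Finset.filter_image, Finset.filter_image,
    Finset.card_union_of_disjoint (disjoint_image_unbarred_barred _ _),
    Finset.card_image_of_injective _ unbarred_injective,
    Finset.card_image_of_injective _ barred_injective]
  simp only [unbarred_lt_unbarred, barred_lt_unbarred]
  rw [Finset.compl_eq_univ_sdiff]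
  simp [Finset.filter_gt_eq_Iio]

/-- The increasing enumeration of the letters of `M_{n,S}`. -/
noncomputable def jsEnum (S : Finset (Fin n)) : Fin (2 * n - S.card) ↪o JSLetter n :=
  (jsLetters S).orderEmbOfFin (card_jsLetters S)

theorem map_jsEnum (S : Finset (Fin n)) :
    Finset.univ.map (jsEnum S).toEmbedding = jsLetters S := by
  rw [← Finset.coe_inj, Finset.coe_map, Finset.coe_univ, Set.image_univ]
  exact Finset.range_orderEmbOfFin _ _

/-- The positions singled out by `multVec` are the ranks of the unbarred letters: below `unbarred p`
lie the smaller unbarred letters and the remaining barred letters with index at most `p`. -/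
theorem jsMult_comp_jsEnum (S : Finset (Fin n)) : jsMult ∘ jsEnum S = multVec S := by
  funext l
  have hrank := card_filter_lt_orderEmb (jsEnum S)
  rw [map_jsEnum] at hrank
  have hiff : (∃ p : Fin n, (l : ℕ) + 1 = ((p : ℕ) + 1) +
      ((Finset.univ \ S).filter (· ≤ p)).card) ↔ ∃ p, jsEnum S l = unbarred p := by
    refine exists_congr fun p => ?_
    have h := card_filter_lt_unbarred S p
    obtain ⟨l', -, hl'⟩ := Finset.mem_map.1
      ((map_jsEnum S).symm ▸ unbarred_mem_jsLetters S p)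
    replace hl' : jsEnum S l' = unbarred p := hl'
    rw [← hl', hrank] at h
    rw [← hl', (jsEnum S).injective.eq_iff, Fin.ext_iff]
    omega
  rw [multVec, Function.comp_apply]
  split_ifs with h
  · obtain ⟨p, hp⟩ := hiff.1 h
    rw [hp, jsMult_unbarred]
  · rw [hiff] at h
    rcases jsLetter_cases (jsEnum S l) with h' | ⟨p, hp⟩
    · exact absurd h' h
    · rw [hp, jsMult_barred]

theorem statPoly_jspSet_eq (S : Finset (Fin n)) :
    statPoly (jspSet n S) = statPoly (genStirlingSet (multVec S)) := by
  rw [jspSet_eq_stirlingWords, genStirlingSet_eq_stirlingWords, ← map_jsEnum,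
    statPoly_stirlingWords_map, jsMult_comp_jsEnum]

theorem multVec_eq_one_or_two (S : Finset (Fin n)) (l : Fin (2 * n - S.card)) :
    multVec S l = 1 ∨ multVec S l = 2 :=
  jsMult_comp_jsEnum S ▸ jsMult_eq_one_or_two _

theorem sum_multVec (S : Finset (Fin n)) : ∑ l, multVec S l = 3 * n - S.card := by
  rw [← sum_jsMult, ← map_jsEnum, Finset.sum_map, ← jsMult_comp_jsEnum]
  rfl

theorem statPoly_jspSet_gamma (hn : 1 ≤ n) {i : ℕ} {S : Finset (Fin n)}
    (hS : S.card = i) :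
    statPoly (jspSet n S) =
      ∑ k ∈ Finset.range (3 * n - i), X 2 ^ k *
        ∑ j ∈ Finset.Icc 1 ((3 * n - i + 1 - k) / 2),
          C (stirlingGamma (multVec S) k j : ℤ) * (X 0 * X 1) ^ j *
            (X 0 + X 1) ^ (3 * n - i + 1 - k - 2 * j) := by
  subst hS
  have : S.card ≤ n := by simpa using S.card_le_univ
  have : NeZero (2 * n - S.card) := ⟨by omega⟩
  rw [statPoly_jspSet_eq]
  exact statPoly_genStirlingSet_eq (multVec_eq_one_or_two S) (sum_multVec S)

theorem disjoint_jspSet {S T : Finset (Fin n)} (h : S ≠ T) :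
    Disjoint (jspSet n S) (jspSet n T) := by
  rw [Finset.disjoint_left]
  intro w hS hT
  refine h (Finset.ext fun a => ?_)
  have := (mem_jspSet.1 hS).1.symm.trans (mem_jspSet.1 hT).1
  have := congrArg (Multiset.count (barred a)) this
  simp only [count_jsMultiset, jsMult_barred, barred_mem_jsLetters] at this
  by_cases h1 : a ∈ S <;> by_cases h2 : a ∈ T <;> simp_all

theorem statPoly_jspSetOfCard (n i : ℕ) :
    statPoly (jspSetOfCard n i) =
      ∑ S ∈ Finset.powersetCard i (Finset.univ : Finset (Fin n)), statPoly (jspSet n S) :=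
  Finset.sum_biUnion fun _ _ _ _ h => disjoint_jspSet h

end JacobiStirling

/-! ### Partial gamma-positivity -/

theorem isPartialGammaPositive_sum (M : ℕ) (γ : ℕ → ℕ → ℕ) :
    IsPartialGammaPositive (∑ k ∈ Finset.range M, X 2 ^ k *
      ∑ j ∈ Finset.Icc 1 ((M + 1 - k) / 2),
        C (γ k j : ℤ) * (X 0 * X 1) ^ j * (X 0 + X 1) ^ (M + 1 - k - 2 * j)) := by
  -- The expansion starts at j = 1, so the coefficient at j = 0 is set to zero.
  refine ⟨M, fun k => ∑ j ∈ Finset.range ((M + 1 - k) / 2 + 1),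
    C (if j = 0 then 0 else (γ k j : ℤ)) * (X 0 * X 1) ^ j * (X 0 + X 1) ^ (M + 1 - k - 2 * j),
    Finset.sum_congr rfl fun k _ => ?_, fun k _ => ⟨M + 1 - k, _, fun j => ?_, rfl⟩⟩
  · dsimp only
    rw [mul_comm, Finset.sum_range_succ', ← Finset.Ico_add_one_right_eq_Icc,
      Finset.sum_Ico_eq_sum_range]
    simp only [if_true, C_0, zero_mul, add_zero, map_sum, map_mul, map_pow, map_add, rename_X,
      rename_C, Nat.add_sub_cancel, if_neg (Nat.succ_ne_zero _)]
    refine congrArg₂ _ (Finset.sum_congr rfl fun j _ => ?_) rfl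
    rw [add_comm 1 j]
    rfl
  · split_ifs
    · exact le_rfl
    · exact Int.natCast_nonneg _

theorem mainTheorem2 (n i : ℕ) (hn : 1 ≤ n) (hi : i ≤ n) :
    IsPartialGammaPositive (statPoly (jspSetOfCard n i)) ∧
    statPoly (jspSetOfCard n i) =
      ∑ S ∈ Finset.powersetCard i (Finset.univ : Finset (Fin n)), statPoly (jspSet n S) ∧
    ∀ S : Finset (Fin n), S.card = i →
      statPoly (jspSet n S) = statPoly (genStirlingSet (multVec S)) ∧
      IsPartialGammaPositive (statPoly (jspSet n S)) ∧
      statPoly (jspSet n S) =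
        ∑ k ∈ Finset.range (3 * n - i), X 2 ^ k *
          ∑ j ∈ Finset.Icc 1 ((3 * n - i + 1 - k) / 2),
            C (stirlingGamma (multVec S) k j : ℤ) * (X 0 * X 1) ^ j *
              (X 0 + X 1) ^ (3 * n - i + 1 - k - 2 * j) := by
  refine ⟨?_, statPoly_jspSetOfCard n i, ?_⟩
  -- The exponents depend on S only through its size i, so the γ-coefficients can be summed over S.
  · have h : statPoly (jspSetOfCard n i) =
        ∑ k ∈ Finset.range (3 * n - i), X 2 ^ k *
          ∑ j ∈ Finset.Icc 1 ((3 * n - i + 1 - k) / 2),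
            C ((∑ S ∈ Finset.powersetCard i (Finset.univ : Finset (Fin n)),
              stirlingGamma (multVec S) k j : ℕ) : ℤ) * (X 0 * X 1) ^ j *
              (X 0 + X 1) ^ (3 * n - i + 1 - k - 2 * j) := by
      rw [statPoly_jspSetOfCard]
      rw [Finset.sum_congr rfl fun S hS =>
        statPoly_jspSet_gamma hn (Finset.mem_powersetCard.1 hS).2, Finset.sum_comm]
      refine Finset.sum_congr rfl fun k _ => ?_
      rw [← Finset.mul_sum, Finset.sum_comm]
      refine congrArg _ (Finset.sum_congr rfl fun j _ => ?_)
      rw [Nat.cast_sum, map_sum, Finset.sum_mul, Finset.sum_mul]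
    rw [h]
    exact isPartialGammaPositive_sum (3 * n - i)
      fun k j => ∑ S ∈ Finset.powersetCard i (Finset.univ : Finset (Fin n)),
        stirlingGamma (multVec S) k j
  · rintro S rfl
    refine ⟨statPoly_jspSet_eq S, ?_, statPoly_jspSet_gamma hn rfl⟩
    rw [statPoly_jspSet_gamma hn rfl]
    exact isPartialGammaPositive_sum _ _
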